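/- For $n\ge 0$, $\phi\in\mathcal S(\mathbf R^n)$ and $u\in\mathcal S'(\mathbf R^n)$, let $V_\phi u(x,\xi)=\langle u, M_\xi T_x\phi\rangle$, with $(M_\xi T_x\phi)(t)=e^{it\cdot\xi}\phi(t-x)$ and with $\langle\cdot,\cdot\rangle$ the extension of $\langle f,g\rangle=\int f\,\overline{g}\,dt$ to $\mathcal S'\times\mathcal S$, be the short-time Fourier transform. Fix a window $\phi\in\mathcal S(\mathbf R^n)\setminus\{0\}$. For $1\le p<\infty$ and $s\ge 0$, the modulation space $M^{p,1}_s(\mathbf R^n)$ is the set of all $u\in\mathcal S'(\mathbf R^n)$ with $$\|u\|_{M^{p,1}_s}=\int_{\mathbf R^n}(1+|\xi|^2)^{s/2}\Big(\int_{\mathbf R^n}|V_\phi u(x,\xi)|^p\,dx\Big)^{1/p}d\xi<\infty .$$ **Theorem (Wiener–Lévy theorem for $M^{p,1}_s$).** Let $1\le p<\infty$ and $s\ge 0$. Every $f\in M^{p,1}_s(\mathbf R^n)$ is given by integration against a unique continuous function, again denoted by $f$. Let $f\in M^{p,1}_s(\mathbf R^n)$, let $K\subset\mathbf R^n$ be compact,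 and let $F$ be a complex analytic function on an open neighbourhood of $f(K)=\{f(x): x\in K\}$ in $\mathbf C$. Then there exists $g\in M^{p,1}_s(\mathbf R^n)$ such that $g(x)=F(f(x))$ for all $x\in K$, where $f(x)$ and $g(x)$ denote the values of the continuous functions. -/

import Mathlib

open MeasureTheory
open scoped ENNReal SchwartzMap

noncomputable section

/-! Fourier convention: the character is `exp (-i x · ξ)`, without a factor `2π`. -/

theorem hasTemperateGrowth_cexp_neg_I :
    Function.HasTemperateGrowth (fun r : ℝ => Complex.exp (-Complex.I * (r : ℂ))) := by
  have hd : ∀ k : ℕ, iteratedDeriv k (fun r : ℝ => Complex.exp (-Complex.I * (r : ℂ)))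
      = fun r : ℝ => (-Complex.I) ^ k * Complex.exp (-Complex.I * (r : ℂ)) := by
    intro k
    induction k with
    | zero => simp
    | succ k ih =>
      rw [iteratedDeriv_succ, ih]
      funext r
      have h1 : HasDerivAt (fun r : ℝ => -Complex.I * (r : ℂ)) (-Complex.I * 1) r :=
        (Complex.ofRealCLM.hasDerivAt (x := r)).const_mul _
      have h2 := (h1.cexp.const_mul ((-Complex.I) ^ k)).deriv
      rw [h2]
      ring
  refine ⟨(contDiff_const.mul Complex.ofRealCLM.contDiff).cexp, fun k => ⟨0, 1, fun r => ?_⟩⟩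
  rw [norm_iteratedFDeriv_eq_norm_iteratedDeriv, hd]
  have h3 : ‖Complex.exp (-Complex.I * (r : ℂ))‖ = 1 := by
    rw [show -Complex.I * (r : ℂ) = ((-r : ℝ) : ℂ) * Complex.I by push_cast; ring]
    exact Complex.norm_exp_ofReal_mul_I _
  rw [norm_mul, norm_pow, norm_neg, Complex.norm_I, h3]
  simp

theorem hasTemperateGrowth_character {n : ℕ} (ξ : EuclideanSpace ℝ (Fin n)) :
    Function.HasTemperateGrowth
      (fun t : EuclideanSpace ℝ (Fin n) => Complex.exp (-Complex.I * ((inner ℝ t ξ : ℝ) : ℂ))) :=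
  hasTemperateGrowth_cexp_neg_I.comp (Function.hasTemperateGrowth_inner_left ξ)

/-- The Schwartz function `t ↦ exp (-i t · ξ) * conj (φ (t - x))`, that is, the complex conjugate of
the time-frequency shift `M_ξ T_x φ`. -/
def conjShift {n : ℕ} (φ : 𝓢(EuclideanSpace ℝ (Fin n), ℂ)) (x ξ : EuclideanSpace ℝ (Fin n)) :
    𝓢(EuclideanSpace ℝ (Fin n), ℂ) :=
  SchwartzMap.smulLeftCLM ℂ
    (fun t : EuclideanSpace ℝ (Fin n) => Complex.exp (-Complex.I * ((inner ℝ t ξ : ℝ) : ℂ)))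
    (SchwartzMap.postcompCLM (Complex.conjCLE : ℂ →L[ℝ] ℂ) (SchwartzMap.compSubConstCLM ℂ x φ))

theorem conjShift_apply {n : ℕ} (φ : 𝓢(EuclideanSpace ℝ (Fin n), ℂ))
    (x ξ t : EuclideanSpace ℝ (Fin n)) :
    conjShift φ x ξ t
      = Complex.exp (-Complex.I * ((inner ℝ t ξ : ℝ) : ℂ)) * (starRingEnd ℂ) (φ (t - x)) := by
  rw [conjShift, SchwartzMap.smulLeftCLM_apply_apply (hasTemperateGrowth_character ξ),
    SchwartzMap.postcompCLM_apply, SchwartzMap.compSubConstCLM_apply]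
  rfl

/-- The short-time Fourier transform `V_φ u (x, ξ) = ⟨u, M_ξ T_x φ⟩` (sesquilinear pairing) of a
tempered distribution `u` with window `φ`. -/
def stft {n : ℕ} (φ : 𝓢(EuclideanSpace ℝ (Fin n), ℂ)) (u : 𝓢'(EuclideanSpace ℝ (Fin n), ℂ))
    (x ξ : EuclideanSpace ℝ (Fin n)) : ℂ :=
  u (conjShift φ x ξ)

/-- The modulation space norm: the `L^q` norm in `ξ` of `⟨ξ⟩ ^ s * ‖V_φ u (·, ξ)‖_{L^p}`, where
`⟨ξ⟩ = (1 + |ξ|^2) ^ (1/2)`, as an extended nonnegative number. -/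
def modulationNorm {n : ℕ} (φ : 𝓢(EuclideanSpace ℝ (Fin n), ℂ)) (p q : ℝ≥0∞) (s : ℝ)
    (u : 𝓢'(EuclideanSpace ℝ (Fin n), ℂ)) : ℝ≥0∞ :=
  eLpNorm (fun ξ : EuclideanSpace ℝ (Fin n) =>
      ENNReal.ofReal (Real.sqrt (1 + ‖ξ‖ ^ 2) ^ s) *
        eLpNorm (fun x : EuclideanSpace ℝ (Fin n) => stft φ u x ξ) p volume)
    q volume

/-- The modulation space `M^{p,q}_s(ℝⁿ)`, computed with the window `φ`. -/
def modulationSpace {n : ℕ} (φ : 𝓢(EuclideanSpace ℝ (Fin n), ℂ)) (p q : ℝ≥0∞) (s : ℝ) :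
    Set (𝓢'(EuclideanSpace ℝ (Fin n), ℂ)) :=
  {u | modulationNorm φ p q s u < ∞}

/-- The continuous function `f` is the tempered distribution `u`: `u` acts on Schwartz functions
by (absolutely convergent) integration against `f`. -/
def IsContinuousRep {n : ℕ} (u : 𝓢'(EuclideanSpace ℝ (Fin n), ℂ))
    (f : EuclideanSpace ℝ (Fin n) → ℂ) : Prop :=
  Continuous f ∧ ∀ ψ : 𝓢(EuclideanSpace ℝ (Fin n), ℂ),
    Integrable (fun x => f x * ψ x) volume ∧ u ψ = ∫ x, f x * ψ x

end

/-! The argument is the classical Wiener–Lévy localization, carried out in an algebra of absolutely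
convergent superpositions of characters and transferred to the modulation space with cutoffs.

Inversion. Integrating over `x` the product of `u` with `|φ(t - x)|²` recovers `‖φ‖₂² u`, and the
Fourier expansion of one factor `φ(t - x)` turns this into an integral of the short-time Fourier
transform. Hölder in `x` shows that `V_φ u`, times an integrable decay weight in `x` and the weight
in `ξ`, is absolutely integrable. The inversion integral therefore converges to a continuous
function `stftInversion` that represents `u` (`isContinuousRep_stftInversion`).

Local equality with superpositions of characters. If `χ` is Schwartz, then `χ f` is a superposition
of characters of finite weighted mass (`exists_isCharSum_mul_stftInversion`). Conversely, a Schwartz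
function times such a superposition lies in the modulation space, because its transform decays
rapidly in `x` and is a frequency convolution with a rapidly decaying function
(`IsCharSum.exists_isContinuousRep_mul`). So locally the two classes agree, and `p` plays no role.

Functional calculus. A superposition carries two masses: `A` without weight and `B` with weight. The
weighted mass of the `k`-th power is at most a polynomial in `k` times `A ^ (k - 1) * B`. Hence a
power series can be applied as soon as `A` alone is below its radius of convergence
(`IsCharSum.comp_hasFPowerSeriesOnBall`). Near a point `a`, the increment `f - f a` agrees with
`τ((t - a)/δ) (f t - f a)`, whose unweighted mass tends to `0` with `δ` by continuity of
translations in `L¹` (`IsCharSum.exists_eventually_eq_sub`); its weighted mass may blow up, but only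
has to be finite. The Taylor series of `F` at `f a` can thus be applied near every `a ∈ K`, and a
finite smooth partition of unity glues the local results. -/

noncomputable section

/-! ### Slices of Schwartz functions on a product -/

section Slice

open Filter Topology BoundedContinuousFunction

variable {Y E : Type*} [NormedAddCommGroup Y] [NormedSpace ℝ Y] [NormedAddCommGroup E]
  [NormedSpace ℝ E]

/-- The function `t ↦ Θ (y, t)` as a Schwartz function. -/
def SchwartzMap.slice (Θ : 𝓢(Y × E, ℂ)) (y : Y) : 𝓢(E, ℂ) :=
  SchwartzMap.compCLMOfAntilipschitz ℂ (g := fun t : E => (y, t)) (K := 1)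
    (by
      have h : (fun t : E => (y, t)) = (fun _ : E => (y, (0 : E))) + ContinuousLinearMap.inr ℝ Y E := by
        ext t <;> simp
      rw [h]
      exact (Function.HasTemperateGrowth.const _).add (ContinuousLinearMap.hasTemperateGrowth _))
    (by
      refine AntilipschitzWith.of_le_mul_dist fun t t' => ?_
      simp [Prod.dist_eq]) Θ

@[simp]
theorem SchwartzMap.slice_apply (Θ : 𝓢(Y × E, ℂ)) (y : Y) (t : E) : Θ.slice y t = Θ (y, t) := rfl

theorem SchwartzMap.iteratedFDeriv_slice (Θ : 𝓢(Y × E, ℂ)) (y : Y) (l : ℕ) (t : E) :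
    iteratedFDeriv ℝ l (Θ.slice y) t = (iteratedFDeriv ℝ l Θ (y, t)).compContinuousLinearMap
      (fun _ => ContinuousLinearMap.inr ℝ Y E) := by
  have h : (Θ.slice y : E → ℂ) = (fun z => Θ (z + (y, 0))) ∘ ContinuousLinearMap.inr ℝ Y E := by
    ext t; simp
  rw [h, ContinuousLinearMap.iteratedFDeriv_comp_right (n := l) _ _ _ le_rfl,
    iteratedFDeriv_comp_add_right]
  · simp
  · exact (Θ.smooth l).comp (contDiff_id.add contDiff_const)

theorem ContinuousMultilinearMap.norm_compContinuousLinearMap_inr_le {l : ℕ}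
    (M : ContinuousMultilinearMap ℝ (fun _ : Fin l => Y × E) ℂ) :
    ‖M.compContinuousLinearMap (fun _ => ContinuousLinearMap.inr ℝ Y E)‖ ≤ ‖M‖ := by
  refine (M.norm_compContinuousLinearMap_le _).trans ?_
  refine mul_le_of_le_one_right (norm_nonneg _) (Finset.prod_le_one (fun _ _ => norm_nonneg _) ?_)
  exact fun _ _ => ContinuousLinearMap.norm_inr_le_one ℝ Y E

theorem SchwartzMap.norm_iteratedFDeriv_slice_le (Θ : 𝓢(Y × E, ℂ)) (y : Y) (l : ℕ) (t : E) :
    ‖iteratedFDeriv ℝ l (Θ.slice y) t‖ ≤ ‖iteratedFDeriv ℝ l Θ (y, t)‖ := by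
  rw [iteratedFDeriv_slice]
  exact ContinuousMultilinearMap.norm_compContinuousLinearMap_inr_le _

theorem SchwartzMap.exists_decay_prod (Θ : 𝓢(Y × E, ℂ)) (k l N : ℕ) :
    ∃ C, 0 ≤ C ∧ ∀ y t, (1 + ‖y‖) ^ N * (‖t‖ ^ k * ‖iteratedFDeriv ℝ l Θ (y, t)‖) ≤ C := by
  refine ⟨2 ^ (N + k) * (Finset.Iic (N + k, l)).sup (fun m => SchwartzMap.seminorm ℝ m.1 m.2) Θ,
    by positivity, fun y t => ?_⟩
  refine le_trans ?_ (SchwartzMap.one_add_le_sup_seminorm_apply (𝕜 := ℝ) (m := (N + k, l)) le_rfl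
    le_rfl Θ (y, t))
  rw [pow_add, mul_assoc]
  have h1 : ‖y‖ ≤ ‖(y, t)‖ := norm_fst_le (y, t)
  have h2 : ‖t‖ ≤ ‖(y, t)‖ := norm_snd_le (y, t)
  have h3 : ‖t‖ ≤ 1 + ‖(y, t)‖ := by linarith
  gcongr

theorem SchwartzMap.exists_seminorm_slice_le (Θ : 𝓢(Y × E, ℂ)) (k l N : ℕ) :
    ∃ C, 0 ≤ C ∧ ∀ y, (1 + ‖y‖) ^ N * SchwartzMap.seminorm ℂ k l (Θ.slice y) ≤ C := by
  obtain ⟨C, hC, h⟩ := Θ.exists_decay_prod k l N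
  refine ⟨C, hC, fun y => ?_⟩
  have hp : 0 < (1 + ‖y‖) ^ N := by positivity
  rw [← le_div_iff₀' hp]
  refine SchwartzMap.seminorm_le_bound _ _ _ _ (by positivity) fun t => ?_
  rw [le_div_iff₀' hp]
  refine le_trans ?_ (h y t)
  gcongr
  exact Θ.norm_iteratedFDeriv_slice_le y l t

/-- Mean value inequality in `y` for fixed `t`: the `y`-derivative of the weighted `l`-th derivative
is controlled by the derivative of order `l + 1` of `Θ`, uniformly in `y` and `t`. -/
theorem SchwartzMap.exists_seminorm_slice_sub_le (Θ : 𝓢(Y × E, ℂ)) (k l : ℕ) :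
    ∃ C, ∀ y y', SchwartzMap.seminorm ℂ k l (Θ.slice y - Θ.slice y') ≤ C * ‖y - y'‖ := by
  obtain ⟨C, hC, h⟩ := Θ.exists_decay_prod k (l + 1) 0
  refine ⟨C, fun y y' => SchwartzMap.seminorm_le_bound _ _ _ _ (by positivity) fun t => ?_⟩
  have hd : Differentiable ℝ (iteratedFDeriv ℝ l Θ) :=
    (Θ.smooth (l + 1)).differentiable_iteratedFDeriv (by exact_mod_cast Nat.lt_succ_self l)
  have e : iteratedFDeriv ℝ l (Θ.slice y - Θ.slice y') t
      = (iteratedFDeriv ℝ l Θ (y, t) - iteratedFDeriv ℝ l Θ (y', t)).compContinuousLinearMap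
        (fun _ => ContinuousLinearMap.inr ℝ Y E) := by
    rw [show ((Θ.slice y - Θ.slice y' : 𝓢(E, ℂ)) : E → ℂ) = (Θ.slice y : E → ℂ) - Θ.slice y' from
      rfl, iteratedFDeriv_sub_apply ((Θ.slice y).smooth l).contDiffAt
        ((Θ.slice y').smooth l).contDiffAt, iteratedFDeriv_slice, iteratedFDeriv_slice]
    rfl
  rw [e]
  have key : ‖‖t‖ ^ k • iteratedFDeriv ℝ l Θ (y, t) - ‖t‖ ^ k • iteratedFDeriv ℝ l Θ (y', t)‖
      ≤ C * ‖y - y'‖ := by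
    refine Convex.norm_image_sub_le_of_norm_hasFDerivWithin_le (s := Set.univ)
      (f := fun z : Y => ‖t‖ ^ k • iteratedFDeriv ℝ l Θ (z, t))
      (f' := fun z => ‖t‖ ^ k • (fderiv ℝ (iteratedFDeriv ℝ l Θ) (z, t)).comp
        (ContinuousLinearMap.inl ℝ Y E)) (fun z _ => ?_) (fun z _ => ?_) convex_univ trivial trivial
    · have h1 : HasFDerivAt (fun z : Y => iteratedFDeriv ℝ l Θ (z, t))
          ((fderiv ℝ (iteratedFDeriv ℝ l Θ) (z, t)).comp (ContinuousLinearMap.inl ℝ Y E)) z :=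
        (hd (z, t)).hasFDerivAt.comp z (hasFDerivAt_prodMk_left z t)
      exact (h1.const_smul (‖t‖ ^ k)).hasFDerivWithinAt
    · rw [norm_smul, norm_pow, norm_norm]
      have h0 := h z t
      rw [pow_zero, one_mul, ← norm_fderiv_iteratedFDeriv] at h0
      refine le_trans ?_ h0
      gcongr
      refine (ContinuousLinearMap.opNorm_comp_le _ _).trans ?_
      exact mul_le_of_le_one_right (norm_nonneg _) (ContinuousLinearMap.norm_inl_le_one ℝ Y E)
  rw [← smul_sub, norm_smul, norm_pow, norm_norm] at key
  refine le_trans ?_ key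
  gcongr
  exact ContinuousMultilinearMap.norm_compContinuousLinearMap_inr_le _

theorem SchwartzMap.continuous_slice (Θ : 𝓢(Y × E, ℂ)) : Continuous Θ.slice := by
  rw [continuous_iff_continuousAt]
  intro y
  rw [ContinuousAt, (schwartz_withSeminorms ℂ E ℂ).tendsto_nhds]
  rintro ⟨k, l⟩ ε hε
  obtain ⟨C, hC⟩ := Θ.exists_seminorm_slice_sub_le k l
  have h : Tendsto (fun y' => C * ‖y' - y‖) (𝓝 y) (𝓝 0) := by
    have : Continuous fun y' => C * ‖y' - y‖ := by fun_prop
    simpa using this.tendsto y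
  filter_upwards [h.eventually_lt_const hε] with y' hy'
  exact (hC y' y).trans_lt hy'

/-- The weighted derivative `x ↦ ‖x‖ ^ k • D ^ l ψ x` of a Schwartz function as a bounded continuous
function. -/
def SchwartzMap.weightedDeriv (k l : ℕ) :
    𝓢(E, ℂ) →ₗ[ℂ] (E →ᵇ ContinuousMultilinearMap ℝ (fun _ : Fin l => E) ℂ) where
  toFun ψ := BoundedContinuousFunction.ofNormedAddCommGroup
    (fun x => ‖x‖ ^ k • iteratedFDeriv ℝ l ψ x)
    ((continuous_norm.pow k).smul ((ψ.smooth l).continuous_iteratedFDeriv le_rfl))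
    (SchwartzMap.seminorm ℂ k l ψ) (fun x => by
      rw [norm_smul, norm_pow, norm_norm]; exact SchwartzMap.le_seminorm ℂ k l ψ x)
  map_add' ψ ψ' := by
    ext1 x
    change ‖x‖ ^ k • iteratedFDeriv ℝ l ((ψ : E → ℂ) + (ψ' : E → ℂ)) x = _
    rw [iteratedFDeriv_add_apply (ψ.smooth l).contDiffAt (ψ'.smooth l).contDiffAt, smul_add]
    rfl
  map_smul' c ψ := by
    ext1 x
    change ‖x‖ ^ k • iteratedFDeriv ℝ l (c • (ψ : E → ℂ)) x = _
    rw [iteratedFDeriv_const_smul_apply (ψ.smooth l).contDiffAt, smul_comm]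
    rfl

theorem SchwartzMap.weightedDeriv_apply (k l : ℕ) (ψ : 𝓢(E, ℂ)) (x : E) :
    SchwartzMap.weightedDeriv k l ψ x = ‖x‖ ^ k • iteratedFDeriv ℝ l ψ x := rfl

theorem SchwartzMap.norm_weightedDeriv (k l : ℕ) (ψ : 𝓢(E, ℂ)) :
    ‖SchwartzMap.weightedDeriv k l ψ‖ = SchwartzMap.seminorm ℂ k l ψ := by
  refine le_antisymm (BoundedContinuousFunction.norm_ofNormedAddCommGroup_le _ (by positivity)
    fun x => ?_) ?_
  · rw [norm_smul, norm_pow, norm_norm]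
    exact SchwartzMap.le_seminorm ℂ k l ψ x
  refine SchwartzMap.seminorm_le_bound _ _ _ _ (by positivity) fun x => ?_
  have := (SchwartzMap.weightedDeriv k l ψ).norm_coe_le_norm x
  rwa [weightedDeriv_apply, norm_smul, norm_pow, norm_norm] at this

/-- The bound forces `ker J ≤ ker u`, so `u` descends to a bounded functional on the range of `J`,
which Hahn–Banach extends to `X`. This allows a Bochner integral in a Banach space to replace an
integral in the Schwartz space, which carries no norm. -/
theorem LinearMap.exists_continuous_factor {V X : Type*} [AddCommGroup V] [Module ℂ V]
    [NormedAddCommGroup X] [NormedSpace ℂ X] (J : V →ₗ[ℂ] X) (u : V →ₗ[ℂ] ℂ) (C : ℝ)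
    (h : ∀ v, ‖u v‖ ≤ C * ‖J v‖) : ∃ w : X →L[ℂ] ℂ, ∀ v, w (J v) = u v := by
  have hker : LinearMap.ker J ≤ LinearMap.ker u := by
    intro v hv
    rw [LinearMap.mem_ker] at hv ⊢
    have := h v
    rw [hv, norm_zero, mul_zero] at this
    exact norm_le_zero_iff.1 this
  let f : LinearMap.range J →ₗ[ℂ] ℂ := (LinearMap.ker J).liftQ u hker ∘ₗ J.quotKerEquivRange.symm
  have hf : ∀ v, f ⟨J v, LinearMap.mem_range_self J v⟩ = u v := by
    intro v
    simp only [f, LinearMap.comp_apply, LinearEquiv.coe_coe,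
      LinearMap.quotKerEquivRange_symm_apply_image]
    simp
  let g : StrongDual ℂ (LinearMap.range J) := f.mkContinuous C (by
    rintro ⟨_, v, rfl⟩
    rw [hf]
    exact h v)
  obtain ⟨w, hw, -⟩ := exists_extension_norm_eq (LinearMap.range J) g
  exact ⟨w, fun v => (hw ⟨J v, LinearMap.mem_range_self J v⟩).trans (hf v)⟩

theorem SchwartzMap.continuous_iteratedFDeriv_slice (Θ : 𝓢(Y × E, ℂ)) (l : ℕ) (t : E) :
    Continuous fun y => iteratedFDeriv ℝ l (Θ.slice y) t := by
  simp_rw [iteratedFDeriv_slice]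
  have h : Continuous fun y : Y => iteratedFDeriv ℝ l Θ (y, t) :=
    ((Θ.smooth l).continuous_iteratedFDeriv le_rfl).comp (by fun_prop)
  exact (ContinuousMultilinearMap.compContinuousLinearMapL
    (fun _ : Fin l => ContinuousLinearMap.inr ℝ Y E)).continuous.comp h

variable [MeasurableSpace Y] [BorelSpace Y] [SecondCountableTopology Y] {ν : Measure Y}
  [ν.HasTemperateGrowth]

theorem integrable_of_one_add_norm_pow_mul_le {F : Type*} [NormedAddCommGroup F] {f : Y → F}
    (hf : AEStronglyMeasurable f ν) {C : ℝ}
    (h : ∀ y, (1 + ‖y‖) ^ ν.integrablePower * ‖f y‖ ≤ C) : Integrable f ν := by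
  refine ((MeasureTheory.Measure.integrable_pow_neg_integrablePower ν).const_mul C).mono' hf (ae_of_all _ fun y => ?_)
  have hp : 0 < 1 + ‖y‖ := by positivity
  rw [Real.rpow_neg hp.le, Real.rpow_natCast, ← div_eq_mul_inv, le_div_iff₀' (by positivity)]
  exact h y

theorem SchwartzMap.integrable_iteratedFDeriv_slice (Θ : 𝓢(Y × E, ℂ)) (l : ℕ) (t : E) :
    Integrable (fun y => iteratedFDeriv ℝ l (Θ.slice y) t) ν := by
  obtain ⟨C, -, hC⟩ := Θ.exists_decay_prod 0 l ν.integrablePower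
  refine integrable_of_one_add_norm_pow_mul_le
    (Θ.continuous_iteratedFDeriv_slice l t).aestronglyMeasurable (C := C) fun y => ?_
  refine le_trans ?_ (hC y t)
  rw [pow_zero, one_mul]
  gcongr
  exact Θ.norm_iteratedFDeriv_slice_le y l t

/-- The isometry `e` stands for uncurrying: in the induction on the order of differentiation,
continuity in `y` is known for the iterated derivative of order `l + 1`, that is, after `e`, and it
is transferred back to the `fderiv`. -/
theorem apply_fderiv_integral_of_dominated {G G' : Type*} [NormedAddCommGroup G] [NormedSpace ℝ G]
    [NormedAddCommGroup G'] [NormedSpace ℝ G'] (e : (E →L[ℝ] G) ≃ₗᵢ[ℝ] G') {f : Y → E → G}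
    (hf : ∀ y, Differentiable ℝ (f y)) (hc : ∀ t, Continuous fun y => f y t)
    (hi : ∀ t, Integrable (fun y => f y t) ν)
    (hc' : ∀ t, Continuous fun y => e (fderiv ℝ (f y) t)) {bound : Y → ℝ}
    (hbi : Integrable bound ν) (hb : ∀ y t, ‖fderiv ℝ (f y) t‖ ≤ bound y) (t : E) :
    e (fderiv ℝ (fun t => ∫ y, f y t ∂ν) t) = ∫ y, e (fderiv ℝ (f y) t) ∂ν := by
  have hcont : Continuous fun y => fderiv ℝ (f y) t :=
    (e.comp_continuous_iff).1 (hc' t)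
  have hd := hasFDerivAt_integral_of_dominated_of_fderiv_le (𝕜 := ℝ) (μ := ν) (s := Set.univ)
    (x₀ := t) (F := fun t y => f y t) (F' := fun t y => fderiv ℝ (f y) t)
    (bound := bound) univ_mem (Eventually.of_forall fun t => (hc t).aestronglyMeasurable)
    (hi t) hcont.aestronglyMeasurable (ae_of_all _ fun y t _ => hb y t) hbi
    (ae_of_all _ fun y t _ => (hf y t).hasFDerivAt)
  rw [hd.fderiv]
  exact (e.toContinuousLinearEquiv.integral_comp_comm _).symm

/-- Differentiation under the integral sign for slices of a Schwartz function. -/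
theorem SchwartzMap.iteratedFDeriv_integral_slice (Θ : 𝓢(Y × E, ℂ)) (l : ℕ) :
    iteratedFDeriv ℝ l (fun t => ∫ y, Θ (y, t) ∂ν)
      = fun t => ∫ y, iteratedFDeriv ℝ l (Θ.slice y) t ∂ν := by
  induction l with
  | zero =>
    ext1 t
    rw [iteratedFDeriv_zero_eq_comp, Function.comp_apply]
    simp_rw [iteratedFDeriv_zero_eq_comp, Function.comp_apply, slice_apply]
    exact ((continuousMultilinearCurryFin0 ℝ E ℂ).symm.toContinuousLinearEquiv.integral_comp_comm
      _).symm
  | succ l ih =>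
    ext1 t
    rw [iteratedFDeriv_succ_eq_comp_left, Function.comp_apply, ih]
    obtain ⟨C, -, hC⟩ := Θ.exists_decay_prod 0 (l + 1) ν.integrablePower
    have hb : ∀ y t, ‖fderiv ℝ (iteratedFDeriv ℝ l (Θ.slice y)) t‖
        ≤ C * (1 + ‖y‖) ^ (-(ν.integrablePower : ℝ)) := by
      intro y t
      have hp : 0 < 1 + ‖y‖ := by positivity
      rw [Real.rpow_neg hp.le, Real.rpow_natCast, ← div_eq_mul_inv, le_div_iff₀' (by positivity),
        norm_fderiv_iteratedFDeriv]
      refine le_trans ?_ (hC y t)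
      rw [pow_zero, one_mul]
      gcongr
      exact Θ.norm_iteratedFDeriv_slice_le y _ t
    refine apply_fderiv_integral_of_dominated
      (continuousMultilinearCurryLeftEquiv ℝ (fun _ : Fin (l + 1) => E) ℂ).symm
      (f := fun y => iteratedFDeriv ℝ l (Θ.slice y))
      (fun y => ((Θ.slice y).smooth (l + 1)).differentiable_iteratedFDeriv
        (by exact_mod_cast Nat.lt_succ_self l))
      (Θ.continuous_iteratedFDeriv_slice l) (Θ.integrable_iteratedFDeriv_slice l)
      (Θ.continuous_iteratedFDeriv_slice (l + 1)) 
      ((MeasureTheory.Measure.integrable_pow_neg_integrablePower ν).const_mul C) hb t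

/-- A linear functional that is bounded by finitely many maps into spaces of bounded continuous
functions commutes with an integral that these maps see as a convergent pointwise integral. -/
theorem LinearMap.apply_eq_integral_of_bounded {V ι : Type*} [AddCommGroup V] [Module ℂ V] [Fintype ι]
    {G : ι → Type*} [∀ i, NormedAddCommGroup (G i)] [∀ i, NormedSpace ℂ (G i)]
    [∀ i, CompleteSpace (G i)] (J : ∀ i, V →ₗ[ℂ] (E →ᵇ G i)) (u : V →ₗ[ℂ] ℂ) (C : ℝ)
    (hu : ∀ v M, 0 ≤ M → (∀ i, ‖J i v‖ ≤ M) → ‖u v‖ ≤ C * M) (Φ : Y → V)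
    (hΦ : ∀ i y₀, Tendsto (fun y => ‖J i (Φ y - Φ y₀)‖) (𝓝 y₀) (𝓝 0))
    (hb : ∀ i, ∃ C, ∀ y, (1 + ‖y‖) ^ ν.integrablePower * ‖J i (Φ y)‖ ≤ C) (v : V)
    (hv : ∀ i t, J i v t = ∫ y, J i (Φ y) t ∂ν) :
    u v = ∫ y, u (Φ y) ∂ν := by
  -- The finitely many maps `J i` are bundled into a single map to a product of Banach spaces; the
  -- integral is taken there and identified with the image of `v` by evaluating at each `i` and `t`.
  obtain ⟨w, hw⟩ := (LinearMap.pi J).exists_continuous_factor u C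
    (fun v => hu v _ (norm_nonneg _) fun i => norm_le_pi_norm (LinearMap.pi J v) i)
  have hc : ∀ i, Continuous fun y => J i (Φ y) := by
    intro i
    rw [continuous_iff_continuousAt]
    intro y₀
    rw [ContinuousAt, tendsto_iff_norm_sub_tendsto_zero]
    simp_rw [← map_sub]
    exact hΦ i y₀
  have hint : ∀ i, Integrable (fun y => J i (Φ y)) ν := by
    intro i
    obtain ⟨C', hC'⟩ := hb i
    exact integrable_of_one_add_norm_pow_mul_le (hc i).aestronglyMeasurable hC'
  have hint' : Integrable (fun y => LinearMap.pi J (Φ y)) ν := Integrable.of_eval hint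
  have hI : ∫ y, LinearMap.pi J (Φ y) ∂ν = LinearMap.pi J v := by
    ext1 i
    ext1 t
    change (∫ y, (fun i => J i (Φ y)) ∂ν) i t = J i v t
    rw [eval_integral hint, hv]
    exact ((BoundedContinuousFunction.evalCLM ℂ t).integral_comp_comm (hint i)).symm
  simp_rw [← hw]
  rw [ContinuousLinearMap.integral_comp_comm _ hint', hI]

/-- A tempered distribution commutes with the integration of the slices of a Schwartz function. -/
theorem TemperedDistribution.apply_eq_integral_slice (u : 𝓢'(E, ℂ)) (Θ : 𝓢(Y × E, ℂ))
    (ψ : 𝓢(E, ℂ)) (hψ : ∀ t, ψ t = ∫ y, Θ (y, t) ∂ν) :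
    u ψ = ∫ y, u (Θ.slice y) ∂ν := by
  obtain ⟨s, C, -, hC⟩ := Seminorm.bound_of_continuous (schwartz_withSeminorms ℂ E ℂ)
    ((normSeminorm ℂ ℂ).comp (u : 𝓢(E, ℂ) →ₗ[ℂ] ℂ)) (continuous_norm.comp (map_continuous u))
  refine LinearMap.apply_eq_integral_of_bounded (ι := s)
    (fun i => SchwartzMap.weightedDeriv (E := E) i.1.1 i.1.2) (u : 𝓢(E, ℂ) →ₗ[ℂ] ℂ) C
    (fun ψ M hM h => ?_) Θ.slice (fun i y => ?_) (fun i => ?_) ψ (fun i t => ?_)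
  · refine (hC ψ).trans ?_
    rw [_root_.smul_apply, NNReal.smul_def, smul_eq_mul]
    gcongr
    refine Seminorm.finset_sup_apply_le hM fun i hi => ?_
    exact (SchwartzMap.norm_weightedDeriv i.1 i.2 ψ).ge.trans (h ⟨i, hi⟩)
  · obtain ⟨C', hC'⟩ := Θ.exists_seminorm_slice_sub_le i.1.1 i.1.2
    have h0 : Tendsto (fun y' => C' * ‖y' - y‖) (𝓝 y) (𝓝 0) := by
      have : Continuous fun y' => C' * ‖y' - y‖ := by fun_prop
      simpa using this.tendsto y
    exact squeeze_zero (fun _ => norm_nonneg _) (fun y' =>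
      (SchwartzMap.norm_weightedDeriv i.1.1 i.1.2 _).le.trans (hC' y' y)) h0
  · obtain ⟨C', -, hC'⟩ := Θ.exists_seminorm_slice_le i.1.1 i.1.2 ν.integrablePower
    exact ⟨C', fun y => (SchwartzMap.norm_weightedDeriv i.1.1 i.1.2 (Θ.slice y)).symm ▸ hC' y⟩
  · simp_rw [SchwartzMap.weightedDeriv_apply]
    rw [integral_smul, show (ψ : E → ℂ) = fun t => ∫ y, Θ (y, t) ∂ν from funext hψ,
      Θ.iteratedFDeriv_integral_slice]

end Slice

/-! ### Tensor products of Schwartz functions and time-frequency shifts -/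

section Tensor

open Filter Topology BoundedContinuousFunction FourierTransform

variable {Y E : Type*} [NormedAddCommGroup Y] [NormedSpace ℝ Y] [NormedAddCommGroup E]
  [NormedSpace ℝ E]

theorem SchwartzMap.exists_one_add_pow_mul_iteratedFDeriv_le (f : 𝓢(E, ℂ)) (k l : ℕ) :
    ∃ C, 0 ≤ C ∧ ∀ x, (1 + ‖x‖) ^ k * ‖iteratedFDeriv ℝ l f x‖ ≤ C :=
  ⟨_, by positivity, fun x => SchwartzMap.one_add_le_sup_seminorm_apply (𝕜 := ℝ) (m := (k, l)) le_rfl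
    le_rfl f x⟩

theorem SchwartzMap.exists_one_add_pow_mul_le (f : 𝓢(E, ℂ)) (k : ℕ) :
    ∃ C, 0 ≤ C ∧ ∀ x, (1 + ‖x‖) ^ k * ‖f x‖ ≤ C := by
  simpa using f.exists_one_add_pow_mul_iteratedFDeriv_le k 0

theorem norm_iteratedFDeriv_comp_le_of_norm_le_one {g : E → ℂ} {l : ℕ} (hg : ContDiff ℝ l g)
    (L : Y →L[ℝ] E) (hL : ‖L‖ ≤ 1) (y : Y) :
    ‖iteratedFDeriv ℝ l (g ∘ L) y‖ ≤ ‖iteratedFDeriv ℝ l g (L y)‖ := by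
  rw [L.iteratedFDeriv_comp_right hg y le_rfl]
  refine (ContinuousMultilinearMap.norm_compContinuousLinearMap_le _ _).trans ?_
  exact mul_le_of_le_one_right (norm_nonneg _)
    (Finset.prod_le_one (fun _ _ => norm_nonneg _) fun _ _ => hL)

/-- The Schwartz function `(y, t) ↦ f y * g t`. -/
def SchwartzMap.tensor (f : 𝓢(Y, ℂ)) (g : 𝓢(E, ℂ)) : 𝓢(Y × E, ℂ) where
  toFun z := f z.1 * g z.2
  smooth' := (f.smooth'.comp contDiff_fst).mul (g.smooth'.comp contDiff_snd)
  decay' k l := by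
    choose A hA0 hA using fun i => f.exists_one_add_pow_mul_iteratedFDeriv_le k i
    choose B hB0 hB using fun i => g.exists_one_add_pow_mul_iteratedFDeriv_le k i
    refine ⟨∑ i ∈ Finset.range (l + 1), (l.choose i : ℝ) * A i * B (l - i), fun z => ?_⟩
    have h1 : ContDiff ℝ l (fun z : Y × E => f z.1) := (f.smooth l).comp contDiff_fst
    have h2 : ContDiff ℝ l (fun z : Y × E => g z.2) := (g.smooth l).comp contDiff_snd
    have h3 := norm_iteratedFDeriv_mul_le (𝕜 := ℝ) h1 h2 z (n := l) le_rfl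
    -- The sup norm satisfies `‖z‖ ≤ (1 + ‖z.1‖) (1 + ‖z.2‖)`, so each factor absorbs its own
    -- weight.
    have hz : ‖z‖ ^ k ≤ (1 + ‖z.1‖) ^ k * (1 + ‖z.2‖) ^ k := by
      rw [← mul_pow]
      refine pow_le_pow_left₀ (norm_nonneg _) ?_ _
      refine (norm_prod_le_iff.2 ⟨?_, ?_⟩ : ‖z‖ ≤ _)
      · nlinarith [norm_nonneg z.1, norm_nonneg z.2]
      · nlinarith [norm_nonneg z.1, norm_nonneg z.2]
    refine (mul_le_mul_of_nonneg_left h3 (by positivity)).trans ?_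
    rw [Finset.mul_sum]
    refine Finset.sum_le_sum fun i hi => ?_
    have h4 : ‖iteratedFDeriv ℝ i (fun z : Y × E => f z.1) z‖ ≤ ‖iteratedFDeriv ℝ i f z.1‖ :=
      norm_iteratedFDeriv_comp_le_of_norm_le_one (f.smooth i) (ContinuousLinearMap.fst ℝ Y E)
        (ContinuousLinearMap.norm_fst_le ℝ Y E) z
    have h5 : ‖iteratedFDeriv ℝ (l - i) (fun z : Y × E => g z.2) z‖
        ≤ ‖iteratedFDeriv ℝ (l - i) g z.2‖ :=
      norm_iteratedFDeriv_comp_le_of_norm_le_one (g.smooth (l - i : ℕ))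
        (ContinuousLinearMap.snd ℝ Y E) (ContinuousLinearMap.norm_snd_le ℝ Y E) z
    calc ‖z‖ ^ k * ((l.choose i : ℝ) * ‖iteratedFDeriv ℝ i (fun z : Y × E => f z.1) z‖
          * ‖iteratedFDeriv ℝ (l - i) (fun z : Y × E => g z.2) z‖)
        ≤ ((1 + ‖z.1‖) ^ k * (1 + ‖z.2‖) ^ k) * ((l.choose i : ℝ) * ‖iteratedFDeriv ℝ i f z.1‖
          * ‖iteratedFDeriv ℝ (l - i) g z.2‖) := by gcongr
      _ = (l.choose i : ℝ) * ((1 + ‖z.1‖) ^ k * ‖iteratedFDeriv ℝ i f z.1‖)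
          * ((1 + ‖z.2‖) ^ k * ‖iteratedFDeriv ℝ (l - i) g z.2‖) := by ring
      _ ≤ (l.choose i : ℝ) * A i * B (l - i) := by
          gcongr
          · exact mul_nonneg (Nat.cast_nonneg _) (hA0 i)
          · exact hA i _
          · exact hB _ _

@[simp]
theorem SchwartzMap.tensor_apply (f : 𝓢(Y, ℂ)) (g : 𝓢(E, ℂ)) (z : Y × E) :
    f.tensor g z = f z.1 * g z.2 := rfl

/-- The Schwartz function `(x, t) ↦ f t * g (t - x)`. -/
def SchwartzMap.mulShift (f g : 𝓢(E, ℂ)) : 𝓢(E × E, ℂ) :=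
  SchwartzMap.compCLMOfContinuousLinearEquiv ℂ
    (ContinuousLinearEquiv.equivOfInverse
      ((ContinuousLinearMap.snd ℝ E E).prod
        (ContinuousLinearMap.snd ℝ E E - ContinuousLinearMap.fst ℝ E E))
      ((ContinuousLinearMap.fst ℝ E E - ContinuousLinearMap.snd ℝ E E).prod
        (ContinuousLinearMap.fst ℝ E E))
      (fun z => by ext <;> simp) (fun z => by ext <;> simp)) (f.tensor g)

theorem SchwartzMap.mulShift_apply (f g : 𝓢(E, ℂ)) (x t : E) :
    f.mulShift g (x, t) = f t * g (t - x) := rfl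

end Tensor

/-! ### Time-frequency shifts as slices, and Fourier transforms of slices -/

section Character

open Filter Topology FourierTransform

variable {Y V : Type*} [NormedAddCommGroup Y] [NormedSpace ℝ Y] [NormedAddCommGroup V]
  [InnerProductSpace ℝ V]

theorem hasTemperateGrowth_character_prod (M : Y →L[ℝ] V) :
    Function.HasTemperateGrowth
      (fun z : Y × V => Complex.exp (-Complex.I * ((inner ℝ z.2 (M z.1) : ℝ) : ℂ))) := by
  have h : Function.HasTemperateGrowth (fun z : Y × V => innerSL ℝ z.2 (M z.1)) :=
    (innerSL ℝ (E := V)).bilinear_hasTemperateGrowth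
      (ContinuousLinearMap.hasTemperateGrowth (ContinuousLinearMap.snd ℝ Y V))
      (ContinuousLinearMap.hasTemperateGrowth (M.comp (ContinuousLinearMap.fst ℝ Y V)))
  exact hasTemperateGrowth_cexp_neg_I.comp h

/-- The Schwartz function `(y, t) ↦ exp (-i t · M y) * (k y * g (t - L y))`. -/
def SchwartzMap.timeFrequencyTensor (k : 𝓢(Y, ℂ)) (g : 𝓢(V, ℂ)) (L M : Y →L[ℝ] V) : 𝓢(Y × V, ℂ) :=
  SchwartzMap.smulLeftCLM ℂ
    (fun z : Y × V => Complex.exp (-Complex.I * ((inner ℝ z.2 (M z.1) : ℝ) : ℂ)))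
    (SchwartzMap.compCLMOfContinuousLinearEquiv ℂ
      ((ContinuousLinearEquiv.refl ℝ Y).skewProd (ContinuousLinearEquiv.refl ℝ V) (-L))
      (k.tensor g))

theorem SchwartzMap.timeFrequencyTensor_apply (k : 𝓢(Y, ℂ)) (g : 𝓢(V, ℂ)) (L M : Y →L[ℝ] V) (y : Y)
    (t : V) :
    k.timeFrequencyTensor g L M (y, t)
      = Complex.exp (-Complex.I * ((inner ℝ t (M y) : ℝ) : ℂ)) * (k y * g (t - L y)) := by
  rw [timeFrequencyTensor, smulLeftCLM_apply_apply (hasTemperateGrowth_character_prod M)]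
  simp [sub_eq_add_neg]

variable [FiniteDimensional ℝ V] [MeasurableSpace V] [BorelSpace V]

/-- By continuity of the Fourier transform, each seminorm of `𝓕 (Θ.slice y)` is bounded by finitely
many seminorms of the slice, and these decay in `y` faster than any power. -/
theorem SchwartzMap.exists_fourier_slice_le (Θ : 𝓢(Y × V, ℂ)) (N M : ℕ) :
    ∃ C, 0 ≤ C ∧ ∀ y η, (1 + ‖y‖) ^ N * ((1 + ‖η‖) ^ M * ‖𝓕 (Θ.slice y) η‖) ≤ C := by
  let q : Seminorm ℂ 𝓢(V, ℂ) := (Finset.Iic (M, 0)).sup (schwartzSeminormFamily ℂ V ℂ)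
  have hq : Continuous q :=
    Seminorm.continuous_finsetSup fun i _ => (schwartz_withSeminorms ℂ V ℂ).continuous_seminorm i
  obtain ⟨s, C, -, hC⟩ := Seminorm.bound_of_continuous (schwartz_withSeminorms ℂ V ℂ)
    (q.comp (SchwartzMap.fourierTransformCLM ℂ : 𝓢(V, ℂ) →L[ℂ] 𝓢(V, ℂ)).toLinearMap)
    (hq.comp (SchwartzMap.fourierTransformCLM ℂ).continuous)
  choose A hA0 hA using fun i : ℕ × ℕ => Θ.exists_seminorm_slice_le i.1 i.2 N
  refine ⟨2 ^ M * (C * ∑ i ∈ s, A i), by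
    have := Finset.sum_nonneg fun i (_ : i ∈ s) => hA0 i
    positivity, fun y η => ?_⟩
  have h1 : (1 + ‖η‖) ^ M * ‖𝓕 (Θ.slice y) η‖ ≤ 2 ^ M * q (𝓕 (Θ.slice y)) := by
    have := SchwartzMap.one_add_le_sup_seminorm_apply (𝕜 := ℂ) (m := (M, 0)) le_rfl
      le_rfl (𝓕 (Θ.slice y)) η
    rw [norm_iteratedFDeriv_zero] at this
    exact this
  have h2 : q (𝓕 (Θ.slice y)) ≤ C * ∑ i ∈ s, schwartzSeminormFamily ℂ V ℂ i (Θ.slice y) := by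
    refine (hC (Θ.slice y)).trans ?_
    rw [_root_.smul_apply, NNReal.smul_def, smul_eq_mul]
    gcongr
    refine (Seminorm.finset_sup_le_sum _ _ _).trans ?_
    change (FunLike.coeAddMonoidHom (Seminorm ℂ 𝓢(V, ℂ)) _ _ _) (Θ.slice y) ≤ _
    rw [map_sum, Finset.sum_apply]
    rfl
  calc (1 + ‖y‖) ^ N * ((1 + ‖η‖) ^ M * ‖𝓕 (Θ.slice y) η‖)
      ≤ (1 + ‖y‖) ^ N * (2 ^ M * (C * ∑ i ∈ s, schwartzSeminormFamily ℂ V ℂ i (Θ.slice y))) := by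
        refine mul_le_mul_of_nonneg_left (h1.trans ?_) (by positivity)
        exact mul_le_mul_of_nonneg_left h2 (by positivity)
    _ = 2 ^ M * (C * ∑ i ∈ s, (1 + ‖y‖) ^ N * schwartzSeminormFamily ℂ V ℂ i (Θ.slice y)) := by
        rw [← Finset.mul_sum]; ring
    _ ≤ 2 ^ M * (C * ∑ i ∈ s, A i) := by
        gcongr with i
        exact hA i y

theorem SchwartzMap.continuous_fourier_slice (Θ : 𝓢(Y × V, ℂ)) :
    Continuous fun z : Y × V => 𝓕 (Θ.slice z.1) z.2 := by
  have h : Continuous fun y => SchwartzMap.toBoundedContinuousFunctionCLM ℂ V ℂ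
      (SchwartzMap.fourierTransformCLM ℂ (Θ.slice y)) :=
    (ContinuousLinearMap.continuous _).comp
      ((ContinuousLinearMap.continuous _).comp Θ.continuous_slice)
  exact continuous_eval.comp
    ((h.comp continuous_fst).prodMk continuous_snd)

end Character

/-! ### Weak inversion formula for the short-time Fourier transform -/

section Inversion

open Filter Topology FourierTransform

variable {n : ℕ}

local notation "𝔼" n => EuclideanSpace ℝ (Fin n)

/-- The complex conjugate of a Schwartz function. -/
def SchwartzMap.conj {E : Type*} [NormedAddCommGroup E] [NormedSpace ℝ E] (φ : 𝓢(E, ℂ)) : 𝓢(E, ℂ) :=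
  SchwartzMap.postcompCLM (Complex.conjCLE : ℂ →L[ℝ] ℂ) φ

@[simp]
theorem SchwartzMap.conj_apply {E : Type*} [NormedAddCommGroup E] [NormedSpace ℝ E] (φ : 𝓢(E, ℂ))
    (t : E) : φ.conj t = (starRingEnd ℂ) (φ t) := rfl

theorem SchwartzMap.slice_timeFrequencyTensor {Y : Type*} [NormedAddCommGroup Y] [NormedSpace ℝ Y]
    (k : 𝓢(Y, ℂ)) (φ : 𝓢(𝔼 n, ℂ)) (L M : Y →L[ℝ] (𝔼 n)) (y : Y) :
    (k.timeFrequencyTensor φ.conj L M).slice y = k y • conjShift φ (L y) (M y) := by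
  ext t
  rw [slice_apply, timeFrequencyTensor_apply, _root_.smul_apply, conjShift_apply, smul_eq_mul,
    conj_apply]
  ring

/-- The family of shifts has no decay in `(x, ξ)`, hence is not the slice family of a Schwartz
function. After multiplication by a bump function in `(x, ξ)` equal to `1` near `z₀` it is one, and
`SchwartzMap.continuous_slice` applies. -/
theorem continuous_conjShift (φ : 𝓢(𝔼 n, ℂ)) :
    Continuous fun z : (𝔼 n) × (𝔼 n) => conjShift φ z.1 z.2 := by
  rw [continuous_iff_continuousAt]
  intro z₀
  let b : ContDiffBump z₀ := ⟨1, 2, one_pos, one_lt_two⟩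
  have hb : HasCompactSupport (fun z => (b z : ℂ)) := b.hasCompactSupport.comp_left Complex.ofReal_zero
  let k : 𝓢((𝔼 n) × (𝔼 n), ℂ) := hb.toSchwartzMap (Complex.ofRealCLM.contDiff.comp b.contDiff)
  have h := ((k.timeFrequencyTensor φ.conj (ContinuousLinearMap.fst ℝ _ _)
    (ContinuousLinearMap.snd ℝ _ _)).continuous_slice).continuousAt (x := z₀)
  refine h.congr ?_
  filter_upwards [b.eventuallyEq_one] with z hz
  rw [SchwartzMap.slice_timeFrequencyTensor]
  have : k z = 1 := by
    change (b z : ℂ) = 1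
    rw [hz]; simp
  rw [this, one_smul]
  rfl

theorem continuous_stft (φ : 𝓢(𝔼 n, ℂ)) (u : 𝓢'(𝔼 n, ℂ)) :
    Continuous fun z : (𝔼 n) × (𝔼 n) => stft φ u z.1 z.2 :=
  (map_continuous u).comp (continuous_conjShift φ)

theorem cexp_neg_I_inner_two_pi_smul (t η : 𝔼 n) :
    Complex.exp (-Complex.I * ((inner ℝ t ((2 * Real.pi) • η) : ℝ) : ℂ))
      = (Real.fourierChar (-(inner ℝ η t)) : ℂ) := by
  rw [Real.fourierChar_apply, inner_smul_right, real_inner_comm]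
  congr 1
  push_cast
  ring

/-- Pairing a tempered distribution with a multiple of the window integrates its short-time Fourier
transform in the frequency variable. -/
theorem TemperedDistribution.apply_conj_shift_mul (φ : 𝓢(𝔼 n, ℂ)) (u : 𝓢'(𝔼 n, ℂ)) (x : 𝔼 n)
    (h ψ : 𝓢(𝔼 n, ℂ)) (hψ : ∀ t, ψ t = (starRingEnd ℂ) (φ (t - x)) * 𝓕 h t) :
    u ψ = ∫ η, h η * stft φ u x ((2 * Real.pi) • η) := by
  have key := u.apply_eq_integral_slice (ν := volume) (h.timeFrequencyTensor
    (SchwartzMap.compSubConstCLM ℂ x φ).conj 0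
      ((2 * Real.pi) • ContinuousLinearMap.id ℝ (𝔼 n))) ψ (fun t => by
    rw [hψ, SchwartzMap.fourier_coe, Real.fourier_eq, ← integral_const_mul]
    refine integral_congr_ae (ae_of_all _ fun η => ?_)
    simp only [SchwartzMap.timeFrequencyTensor_apply]
    have := cexp_neg_I_inner_two_pi_smul t η
    simp only [_root_.smul_apply, ContinuousLinearMap.id_apply] at this ⊢
    rw [this, SchwartzMap.conj_apply, Circle.smul_def, smul_eq_mul]
    simp
    ring)
  rw [key]
  refine integral_congr_ae (ae_of_all _ fun η => ?_)
  simp only [SchwartzMap.slice_timeFrequencyTensor, map_smul, smul_eq_mul, stft]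
  congr 2
  ext t
  simp [conjShift_apply]

/-- Weak inversion formula of the short-time Fourier transform. -/
theorem TemperedDistribution.integral_norm_sq_mul_apply (φ : 𝓢(𝔼 n, ℂ)) (u : 𝓢'(𝔼 n, ℂ))
    (ψ : 𝓢(𝔼 n, ℂ)) :
    (∫ t, ((‖φ t‖ ^ 2 : ℝ) : ℂ)) * u ψ
      = ∫ x, ∫ η, 𝓕⁻ ((ψ.mulShift φ).slice x) η * stft φ u x ((2 * Real.pi) • η) := by
  -- `ρ = |φ|²`: integrating `ψ(t) ρ(t - x)` over `x` gives `‖φ‖₂² ψ(t)`. Each slice is then split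
  -- as `conj φ(t - x)` times `ψ(t) φ(t - x)`, the second factor being expanded by Fourier
  -- inversion.
  let ρ : 𝓢(𝔼 n, ℂ) := SchwartzMap.smulLeftCLM ℂ φ.conj φ
  have hρ : ∀ t, ρ t = (starRingEnd ℂ) (φ t) * φ t := fun t =>
    SchwartzMap.smulLeftCLM_apply_apply φ.conj.hasTemperateGrowth φ t
  have key := u.apply_eq_integral_slice (ν := volume) (ψ.mulShift ρ)
    ((∫ t, ((‖φ t‖ ^ 2 : ℝ) : ℂ)) • ψ) (fun t => by
      simp only [SchwartzMap.mulShift_apply]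
      rw [integral_const_mul, integral_sub_left_eq_self (fun x => ρ x), _root_.smul_apply,
        smul_eq_mul, mul_comm]
      congr 2
      ext1 t
      rw [hρ, ← Complex.normSq_eq_conj_mul_self, Complex.normSq_eq_norm_sq])
  rw [map_smul, smul_eq_mul] at key
  rw [key]
  refine integral_congr_ae (ae_of_all _ fun x => ?_)
  refine u.apply_conj_shift_mul φ x _ _ fun t => ?_
  rw [FourierTransform.fourier_fourierInv_eq, SchwartzMap.slice_apply, SchwartzMap.slice_apply,
    SchwartzMap.mulShift_apply, SchwartzMap.mulShift_apply, hρ]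
  ring

end Inversion

/-! ### Absolute convergence and inversion on modulation spaces -/

section Weights

variable {V : Type*} [NormedAddCommGroup V]

/-- The polynomial weight `(1 + ‖ξ‖) ^ s`. -/
def polyWeight (s : ℝ) (ξ : V) : ℝ := (1 + ‖ξ‖) ^ s

theorem polyWeight_pos (s : ℝ) (ξ : V) : 0 < polyWeight s ξ := by
  unfold polyWeight; positivity

theorem one_le_polyWeight {s : ℝ} (hs : 0 ≤ s) (ξ : V) : 1 ≤ polyWeight s ξ :=
  Real.one_le_rpow (by linarith [norm_nonneg ξ]) hs

theorem polyWeight_add_le {s : ℝ} (hs : 0 ≤ s) (ξ η : V) :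
    polyWeight s (ξ + η) ≤ polyWeight s ξ * polyWeight s η := by
  unfold polyWeight
  rw [← Real.mul_rpow (by positivity) (by positivity)]
  refine Real.rpow_le_rpow (by positivity) ?_ hs
  nlinarith [norm_add_le ξ η, norm_nonneg ξ, norm_nonneg η]

theorem continuous_polyWeight (s : ℝ) : Continuous (polyWeight s : V → ℝ) := by
  unfold polyWeight
  exact (continuous_const.add continuous_norm).rpow_const fun ξ =>
    Or.inl (by change 1 + ‖ξ‖ ≠ 0; positivity)

theorem polyWeight_le_sqrt {s : ℝ} (hs : 0 ≤ s) (ξ : V) :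
    polyWeight s ξ ≤ 2 ^ s * Real.sqrt (1 + ‖ξ‖ ^ 2) ^ s := by
  unfold polyWeight
  rw [← Real.mul_rpow (by positivity) (by positivity)]
  refine Real.rpow_le_rpow (by positivity) ?_ hs
  have h1 : 1 ≤ Real.sqrt (1 + ‖ξ‖ ^ 2) := Real.one_le_sqrt.2 (by nlinarith [norm_nonneg ξ])
  have h2 : ‖ξ‖ ≤ Real.sqrt (1 + ‖ξ‖ ^ 2) := Real.le_sqrt_of_sq_le (by linarith)
  linarith

theorem sqrt_rpow_le_polyWeight {s : ℝ} (hs : 0 ≤ s) (ξ : V) :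
    Real.sqrt (1 + ‖ξ‖ ^ 2) ^ s ≤ polyWeight s ξ := by
  unfold polyWeight
  refine Real.rpow_le_rpow (by positivity) ?_ hs
  exact Real.sqrt_le_iff.2 ⟨by positivity, by nlinarith [norm_nonneg ξ]⟩

variable [MeasureSpace V]

/-- An integrable negative power of `1 + ‖x‖`. -/
def decayWeight (x : V) : ℝ := ((1 + ‖x‖) ^ (volume : Measure V).integrablePower)⁻¹

theorem decayWeight_pos (x : V) : 0 < decayWeight x := by
  unfold decayWeight; positivity

theorem decayWeight_le_one (x : V) : decayWeight x ≤ 1 :=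
  inv_le_one_of_one_le₀ (one_le_pow₀ (by linarith [norm_nonneg x]))

theorem continuous_decayWeight : Continuous (decayWeight : V → ℝ) := by
  unfold decayWeight
  exact ((continuous_const.add continuous_norm).pow _).inv₀ fun x =>
    pow_ne_zero _ (by change 1 + ‖x‖ ≠ 0; positivity)

/-- Peetre-type inequality: a shift of the argument costs only a polynomial in the shift. It
separates `t` from `x` in bounds for `φ(t - x)`. -/
theorem decayWeight_sub_le (t x : V) :
    decayWeight (t - x) ≤ (1 + ‖t‖) ^ (volume : Measure V).integrablePower * decayWeight x := by
  unfold decayWeight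
  rw [← div_eq_mul_inv, inv_eq_one_div, div_le_div_iff₀ (by positivity) (by positivity), one_mul,
    ← mul_pow]
  refine pow_le_pow_left₀ (by positivity) ?_ _
  have : ‖x‖ ≤ ‖t‖ + ‖t - x‖ := by
    have := norm_sub_le t (t - x)
    rwa [sub_sub_cancel] at this
  nlinarith [norm_nonneg t, norm_nonneg (t - x)]

theorem integrable_decayWeight [(volume : Measure V).HasTemperateGrowth] :
    Integrable (decayWeight : V → ℝ) := by
  refine (Measure.integrable_pow_neg_integrablePower (volume : Measure V)).congr
    (Filter.Eventually.of_forall fun x => ?_)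
  simp only [decayWeight]
  rw [Real.rpow_neg (by positivity), Real.rpow_natCast]

theorem memLp_decayWeight [BorelSpace V] [SecondCountableTopology V]
    [(volume : Measure V).HasTemperateGrowth] {p : ℝ≥0∞} (hp : 1 ≤ p) :
    MemLp (decayWeight : V → ℝ) p := by
  rcases eq_or_ne p ∞ with rfl | hp'
  · refine memLp_top_of_bound continuous_decayWeight.aestronglyMeasurable 1
      (Filter.Eventually.of_forall fun x => ?_)
    rw [Real.norm_of_nonneg (decayWeight_pos x).le]
    exact decayWeight_le_one x
  · rw [← integrable_norm_rpow_iff continuous_decayWeight.aestronglyMeasurable (by positivity) hp']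
    refine integrable_decayWeight.mono'
      (continuous_decayWeight.norm.rpow_const fun x => Or.inr (by positivity)).aestronglyMeasurable
      (Filter.Eventually.of_forall fun x => ?_)
    rw [Real.norm_of_nonneg (by positivity), Real.norm_of_nonneg (decayWeight_pos x).le]
    refine (Real.rpow_le_rpow_of_exponent_ge (decayWeight_pos x) (decayWeight_le_one x)
      (y := p.toReal) (z := 1) ?_).trans_eq (Real.rpow_one _)
    rw [← ENNReal.toReal_one]
    exact ENNReal.toReal_mono hp' hp

end Weights

/-! ### Pointwise inversion and the continuous representative -/

section Inversion

open Filter Topology FourierTransform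

variable {n : ℕ}

local notation "𝔼" n => EuclideanSpace ℝ (Fin n)

theorem SchwartzMap.exists_norm_le_decayWeight (φ : 𝓢(𝔼 n, ℂ)) :
    ∃ C, 0 ≤ C ∧ ∀ x, ‖φ x‖ ≤ C * decayWeight x := by
  obtain ⟨C, hC, h⟩ := φ.exists_one_add_pow_mul_le (volume : Measure (𝔼 n)).integrablePower
  refine ⟨C, hC, fun x => ?_⟩
  rw [decayWeight, ← div_eq_mul_inv, le_div_iff₀' (by positivity)]
  exact h x

theorem SchwartzMap.exists_norm_shift_le_decayWeight (φ : 𝓢(𝔼 n, ℂ)) :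
    ∃ C, 0 ≤ C ∧ ∀ t x, ‖φ (t - x)‖
      ≤ C * (1 + ‖t‖) ^ (volume : Measure (𝔼 n)).integrablePower * decayWeight x := by
  obtain ⟨C, hC, h⟩ := φ.exists_norm_le_decayWeight
  refine ⟨C, hC, fun t x => (h _).trans ?_⟩
  rw [mul_assoc]
  exact mul_le_mul_of_nonneg_left (decayWeight_sub_le t x) hC

theorem SchwartzMap.exists_fourier_slice_le_decayWeight (Θ : 𝓢((𝔼 n) × (𝔼 n), ℂ)) (M : ℕ) :
    ∃ C, 0 ≤ C ∧ ∀ x η, ‖𝓕 (Θ.slice x) η‖ ≤ C * decayWeight x * ((1 + ‖η‖) ^ M)⁻¹ := by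
  obtain ⟨C, hC, h⟩ :=
    Θ.exists_fourier_slice_le (volume : Measure (𝔼 n)).integrablePower M
  refine ⟨C, hC, fun x η => ?_⟩
  rw [decayWeight, ← div_eq_mul_inv, ← div_eq_mul_inv, div_div, le_div_iff₀' (by positivity),
    mul_assoc]
  exact h x η

theorem continuous_stft_smul (φ : 𝓢(𝔼 n, ℂ)) (u : 𝓢'(𝔼 n, ℂ)) :
    Continuous fun z : (𝔼 n) × (𝔼 n) => stft φ u z.1 ((2 * Real.pi) • z.2) := by
  have h := (continuous_stft φ u).comp
    (continuous_fst.prodMk (continuous_snd.const_smul (2 * Real.pi)))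
  exact h

/-- Hölder in `x`; `(1 - p⁻¹)⁻¹` is the conjugate exponent, equal to `∞` for `p = 1`. The decay
weight lies in every `L^q` with `q ≥ 1`. -/
theorem lintegral_stft_mul_decayWeight_le {p : ℝ≥0∞} (hp : 1 ≤ p) (φ : 𝓢(𝔼 n, ℂ)) (u : 𝓢'(𝔼 n, ℂ))
    (ξ : 𝔼 n) :
    ∫⁻ x, ‖stft φ u x ξ‖ₑ * ENNReal.ofReal (decayWeight x)
      ≤ eLpNorm (fun x => stft φ u x ξ) p volume
        * eLpNorm (decayWeight : (𝔼 n) → ℝ) (1 - p⁻¹)⁻¹ volume := by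
  have := ENNReal.HolderConjugate.inv_one_sub_inv' hp
  have := ENNReal.HolderConjugate.symm (p := p) (q := (1 - p⁻¹)⁻¹)
  have hm : AEStronglyMeasurable (fun x => stft φ u x ξ) volume :=
    ((continuous_stft φ u).comp (by fun_prop : Continuous fun x => (x, ξ))).aestronglyMeasurable
  have h := eLpNorm_smul_le_mul_eLpNorm (p := (1 - p⁻¹)⁻¹) (q := p) (r := 1) hm
    (continuous_decayWeight (V := 𝔼 n)).aestronglyMeasurable
  rw [mul_comm (eLpNorm _ p _)]
  refine le_trans (le_of_eq ?_) h
  rw [eLpNorm_one_eq_lintegral_enorm]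
  refine lintegral_congr fun x => ?_
  rw [Pi.smul_apply', enorm_smul, Real.enorm_of_nonneg (decayWeight_pos x).le, mul_comm]

theorem integrable_stft_mul_weights {p : ℝ≥0∞} (hp : 1 ≤ p) {s : ℝ} (hs : 0 ≤ s)
    (φ : 𝓢(𝔼 n, ℂ)) (u : 𝓢'(𝔼 n, ℂ)) (hu : u ∈ modulationSpace φ p 1 s) :
    Integrable (fun z : (𝔼 n) × (𝔼 n) => ‖stft φ u z.1 ((2 * Real.pi) • z.2)‖
      * (decayWeight z.1 * polyWeight s ((2 * Real.pi) • z.2))) (volume.prod volume) := by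
  have hVc := continuous_stft_smul φ u
  have hc : Continuous (fun z : (𝔼 n) × (𝔼 n) => ‖stft φ u z.1 ((2 * Real.pi) • z.2)‖
      * (decayWeight z.1 * polyWeight s ((2 * Real.pi) • z.2))) :=
    hVc.norm.mul ((continuous_decayWeight.comp continuous_fst).mul
      ((continuous_polyWeight s).comp (by fun_prop)))
  refine ⟨hc.aestronglyMeasurable, ?_⟩
  -- `G` collects the `x`-integral at frequency `ξ`. The integral sought is that of `G (2π η)`, and
  -- the dilation by `2π` only contributes a constant factor.
  let G : (𝔼 n) → ℝ≥0∞ := fun ξ =>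
    (∫⁻ x, ‖stft φ u x ξ‖ₑ * ENNReal.ofReal (decayWeight x)) * ENNReal.ofReal (polyWeight s ξ)
  have hGm : Measurable G := by
    refine Measurable.mul ?_ (continuous_polyWeight s).measurable.ennreal_ofReal
    refine Measurable.lintegral_prod_left'
      (f := fun z : (𝔼 n) × (𝔼 n) => ‖stft φ u z.1 z.2‖ₑ * ENNReal.ofReal (decayWeight z.1)) ?_
    exact (continuous_stft φ u).measurable.enorm.mul
      (continuous_decayWeight.measurable.comp measurable_fst).ennreal_ofReal
  have hG : ∫⁻ ξ, G ξ < ∞ := by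
    set D := eLpNorm (decayWeight : (𝔼 n) → ℝ) (1 - p⁻¹)⁻¹ volume
    have hD : D < ∞ := (memLp_decayWeight (by simp)).2
    have hu' : ∫⁻ ξ : 𝔼 n, ENNReal.ofReal (Real.sqrt (1 + ‖ξ‖ ^ 2) ^ s)
        * eLpNorm (fun x => stft φ u x ξ) p volume < ∞ := by
      have h : modulationNorm φ p 1 s u < ∞ := hu
      rw [modulationNorm, eLpNorm_one_eq_lintegral_enorm] at h
      exact h
    calc ∫⁻ ξ, G ξ ≤ ∫⁻ ξ : 𝔼 n, (D * ENNReal.ofReal (2 ^ s))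
            * (ENNReal.ofReal (Real.sqrt (1 + ‖ξ‖ ^ 2) ^ s)
              * eLpNorm (fun x => stft φ u x ξ) p volume) := by
          refine lintegral_mono fun ξ => ?_
          calc G ξ ≤ (eLpNorm (fun x => stft φ u x ξ) p volume * D)
                * ENNReal.ofReal (2 ^ s * Real.sqrt (1 + ‖ξ‖ ^ 2) ^ s) := by
                exact mul_le_mul' (lintegral_stft_mul_decayWeight_le hp φ u ξ)
                  (ENNReal.ofReal_le_ofReal (polyWeight_le_sqrt hs ξ))
            _ = _ := by
                rw [ENNReal.ofReal_mul (by positivity)]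
                ring
      _ = (D * ENNReal.ofReal (2 ^ s)) * ∫⁻ ξ : 𝔼 n, (ENNReal.ofReal (Real.sqrt (1 + ‖ξ‖ ^ 2) ^ s)
              * eLpNorm (fun x => stft φ u x ξ) p volume) :=
          lintegral_const_mul' _ _ (ENNReal.mul_ne_top hD.ne ENNReal.ofReal_ne_top)
      _ < ∞ := ENNReal.mul_lt_top (ENNReal.mul_lt_top hD ENNReal.ofReal_lt_top) hu'
  have h1 : ∫⁻ z : (𝔼 n) × (𝔼 n), ‖‖stft φ u z.1 ((2 * Real.pi) • z.2)‖
      * (decayWeight z.1 * polyWeight s ((2 * Real.pi) • z.2))‖ₑ ∂(volume.prod volume)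
      = ∫⁻ η, G ((2 * Real.pi) • η) := by
    rw [lintegral_prod_symm _ hc.measurable.enorm.aemeasurable]
    refine lintegral_congr fun η => ?_
    simp only [G]
    rw [← lintegral_mul_const' _ _ ENNReal.ofReal_ne_top]
    refine lintegral_congr fun x => ?_
    rw [enorm_mul, enorm_norm, Real.enorm_of_nonneg
      (mul_pos (decayWeight_pos x) (polyWeight_pos s _)).le,
      ENNReal.ofReal_mul (decayWeight_pos x).le, mul_assoc]
  rw [HasFiniteIntegral, h1, ← lintegral_map hGm (measurable_const_smul (2 * Real.pi)),
    Measure.map_addHaar_smul _ (by positivity), lintegral_smul_measure, smul_eq_mul]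
  exact ENNReal.mul_lt_top ENNReal.ofReal_lt_top hG

theorem SchwartzMap.integral_norm_sq_pos {φ : 𝓢(𝔼 n, ℂ)} (hφ : φ ≠ 0) : 0 < ∫ t, ‖φ t‖ ^ 2 := by
  have hc : Continuous fun t => ‖φ t‖ ^ 2 := by fun_prop
  obtain ⟨a, ha⟩ : ∃ a, φ a ≠ 0 := by
    by_contra! h
    exact hφ (by ext t; simpa using h t)
  have hi : Integrable fun t => ‖φ t‖ ^ 2 :=
    (memLp_two_iff_integrable_sq_norm φ.continuous.aestronglyMeasurable).1 (φ.memLp 2)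
  rw [integral_pos_iff_support_of_nonneg (fun t => by positivity) hi]
  exact hc.isOpen_support.measure_pos _ ⟨a, by simpa using ha⟩

/-- The function given by the inversion formula of the short-time Fourier transform. -/
def stftInversion (φ : 𝓢(𝔼 n, ℂ)) (u : 𝓢'(𝔼 n, ℂ)) (t : 𝔼 n) : ℂ :=
  (∫ y, ((‖φ y‖ ^ 2 : ℝ) : ℂ))⁻¹ * ∫ z : (𝔼 n) × (𝔼 n), stft φ u z.1 ((2 * Real.pi) • z.2)
    * (φ (t - z.1) * (Real.fourierChar (inner ℝ z.2 t) : ℂ)) ∂(volume.prod volume)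

theorem continuous_stft_mul_shift (φ : 𝓢(𝔼 n, ℂ)) (u : 𝓢'(𝔼 n, ℂ)) :
    Continuous fun w : ((𝔼 n) × (𝔼 n)) × (𝔼 n) => stft φ u w.1.1 ((2 * Real.pi) • w.1.2)
    * (φ (w.2 - w.1.1) * (Real.fourierChar (inner ℝ w.1.2 w.2) : ℂ)) := by
  have h1 := (continuous_stft_smul φ u).comp (continuous_fst (X := (𝔼 n) × (𝔼 n)) (Y := 𝔼 n))
  have h2 : Continuous fun w : ((𝔼 n) × (𝔼 n)) × (𝔼 n) => φ (w.2 - w.1.1) := by fun_prop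
  have h3 : Continuous fun w : ((𝔼 n) × (𝔼 n)) × (𝔼 n) =>
      (Real.fourierChar (inner ℝ w.1.2 w.2) : ℂ) :=
    continuous_subtype_val.comp (Real.continuous_fourierChar.comp (by fun_prop))
  exact h1.mul (h2.mul h3)

variable {p : ℝ≥0∞} {s : ℝ} {φ : 𝓢(𝔼 n, ℂ)} {u : 𝓢'(𝔼 n, ℂ)}

theorem integrable_stft_mul_decayWeight (hp : 1 ≤ p) (hs : 0 ≤ s)
    (hu : u ∈ modulationSpace φ p 1 s) :
    Integrable (fun z : (𝔼 n) × (𝔼 n) => ‖stft φ u z.1 ((2 * Real.pi) • z.2)‖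
      * decayWeight z.1) (volume.prod volume) := by
  have hVc := continuous_stft_smul φ u
  refine (integrable_stft_mul_weights hp hs φ u hu).mono'
    (hVc.norm.mul (continuous_decayWeight.comp continuous_fst)).aestronglyMeasurable
    (Eventually.of_forall fun z => ?_)
  have := decayWeight_pos z.1
  rw [Real.norm_of_nonneg (by positivity)]
  gcongr
  exact le_mul_of_one_le_right this.le (one_le_polyWeight hs _)

theorem continuous_stftInversion (hp : 1 ≤ p) (hs : 0 ≤ s) (hu : u ∈ modulationSpace φ p 1 s) :
    Continuous (stftInversion φ u) := by
  refine continuous_const.mul (continuous_iff_continuousAt.2 fun t₀ => ?_)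
  obtain ⟨C, hC, h⟩ := φ.exists_norm_shift_le_decayWeight
  have hcont := continuous_stft_mul_shift φ u
  refine continuousAt_of_dominated
    (bound := fun z => C * (2 + ‖t₀‖) ^ (volume : Measure (𝔼 n)).integrablePower
      * (‖stft φ u z.1 ((2 * Real.pi) • z.2)‖ * decayWeight z.1))
    (Eventually.of_forall fun t => (hcont.comp
      (by fun_prop : Continuous fun z => (z, t))).aestronglyMeasurable) ?_
    ((integrable_stft_mul_decayWeight hp hs hu).const_mul _)
    (Eventually.of_forall fun z => (hcont.comp
      (by fun_prop : Continuous fun t => (z, t))).continuousAt)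
  filter_upwards [Metric.ball_mem_nhds t₀ one_pos] with t ht
  refine Eventually.of_forall fun z => ?_
  have ht' : 1 + ‖t‖ ≤ 2 + ‖t₀‖ := by
    rw [mem_ball_iff_norm] at ht
    linarith [norm_le_norm_add_norm_sub t₀ t, norm_sub_norm_le t t₀]
  rw [norm_mul, norm_mul, Circle.norm_coe, mul_one]
  calc ‖stft φ u z.1 ((2 * Real.pi) • z.2)‖ * ‖φ (t - z.1)‖
      ≤ ‖stft φ u z.1 ((2 * Real.pi) • z.2)‖ * (C * (2 + ‖t₀‖)
        ^ (volume : Measure (𝔼 n)).integrablePower * decayWeight z.1) := by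
        gcongr
        refine (h t z.1).trans ?_
        have := decayWeight_pos z.1
        gcongr
    _ = _ := by ring

/-- Supplies the Fubini hypothesis for exchanging the pairing with `ψ` and the inversion integral:
the growth in `t` produced by shifting `φ` is absorbed by `ψ`. -/
theorem integrable_stft_mul_shift_mul (hp : 1 ≤ p) (hs : 0 ≤ s) (hu : u ∈ modulationSpace φ p 1 s)
    (ψ : 𝓢(𝔼 n, ℂ)) :
    Integrable (fun w : ((𝔼 n) × (𝔼 n)) × (𝔼 n) => stft φ u w.1.1 ((2 * Real.pi) • w.1.2)
      * (φ (w.2 - w.1.1) * (Real.fourierChar (inner ℝ w.1.2 w.2) : ℂ)) * ψ w.2)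
      ((volume.prod volume).prod volume) := by
  obtain ⟨C, hC, h⟩ := φ.exists_norm_shift_le_decayWeight
  set N := (volume : Measure (𝔼 n)).integrablePower with hN
  have h1 := (integrable_stft_mul_decayWeight hp hs hu).mul_prod (ν := volume)
    (g := fun t => C * ((1 + ‖t‖) ^ N * ‖ψ t‖)) (by
      obtain ⟨A, hA, hA'⟩ := ψ.exists_one_add_pow_mul_le (N + N)
      refine Integrable.const_mul (integrable_of_one_add_norm_pow_mul_le
        (by fun_prop : Continuous fun t => (1 + ‖t‖) ^ N * ‖ψ t‖).aestronglyMeasurable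
        (C := A) fun t => ?_) _
      refine le_trans (le_of_eq ?_) (hA' t)
      rw [Real.norm_of_nonneg (by positivity), pow_add]
      ring)
  refine h1.mono' ((continuous_stft_mul_shift φ u).mul (by fun_prop)).aestronglyMeasurable
    (Eventually.of_forall fun w => ?_)
  rw [norm_mul, norm_mul, norm_mul, Circle.norm_coe, mul_one]
  calc ‖stft φ u w.1.1 ((2 * Real.pi) • w.1.2)‖ * ‖φ (w.2 - w.1.1)‖ * ‖ψ w.2‖
      ≤ ‖stft φ u w.1.1 ((2 * Real.pi) • w.1.2)‖
        * (C * (1 + ‖w.2‖) ^ N * decayWeight w.1.1) * ‖ψ w.2‖ := by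
        gcongr
        exact h _ _
    _ = _ := by ring

theorem integral_norm_sq_mul_apply_eq (hp : 1 ≤ p) (hs : 0 ≤ s)
    (hu : u ∈ modulationSpace φ p 1 s) (ψ : 𝓢(𝔼 n, ℂ)) :
    (∫ y, ((‖φ y‖ ^ 2 : ℝ) : ℂ)) * u ψ = ∫ t, ∫ z : (𝔼 n) × (𝔼 n),
      stft φ u z.1 ((2 * Real.pi) • z.2) * (φ (t - z.1)
        * (Real.fourierChar (inner ℝ z.2 t) : ℂ)) * ψ t ∂(volume.prod volume) := by
  have hint := integrable_stft_mul_shift_mul hp hs hu ψ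
  have hg : ∀ x η, 𝓕⁻ ((ψ.mulShift φ).slice x) η * stft φ u x ((2 * Real.pi) • η)
      = ∫ t, stft φ u x ((2 * Real.pi) • η) * (φ (t - x)
        * (Real.fourierChar (inner ℝ η t) : ℂ)) * ψ t := by
    intro x η
    rw [SchwartzMap.fourierInv_coe, Real.fourierInv_eq, ← integral_mul_const]
    refine integral_congr_ae (Eventually.of_forall fun t => ?_)
    simp only [SchwartzMap.slice_apply, SchwartzMap.mulShift_apply]
    rw [Circle.smul_def, smul_eq_mul, real_inner_comm]
    ring
  rw [u.integral_norm_sq_mul_apply φ ψ]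
  simp_rw [hg]
  have h1 := integral_prod (μ := volume) (ν := volume)
    (fun z : (𝔼 n) × (𝔼 n) => ∫ t, stft φ u z.1 ((2 * Real.pi) • z.2)
    * (φ (t - z.1) * (Real.fourierChar (inner ℝ z.2 t) : ℂ)) * ψ t) hint.integral_prod_left
  refine h1.symm.trans ?_
  exact integral_integral_swap hint

theorem isContinuousRep_stftInversion (hp : 1 ≤ p) (hs : 0 ≤ s) (hφ : φ ≠ 0)
    (hu : u ∈ modulationSpace φ p 1 s) : IsContinuousRep u (stftInversion φ u) := by
  refine ⟨continuous_stftInversion hp hs hu, fun ψ => ?_⟩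
  have hint := integrable_stft_mul_shift_mul hp hs hu ψ
  have hc0 : (∫ y, ((‖φ y‖ ^ 2 : ℝ) : ℂ)) ≠ 0 := by
    rw [integral_complex_ofReal]
    exact_mod_cast (SchwartzMap.integral_norm_sq_pos hφ).ne'
  have hf : ∀ t, stftInversion φ u t * ψ t = (∫ y, ((‖φ y‖ ^ 2 : ℝ) : ℂ))⁻¹ *
      ∫ z : (𝔼 n) × (𝔼 n), stft φ u z.1 ((2 * Real.pi) • z.2) * (φ (t - z.1)
        * (Real.fourierChar (inner ℝ z.2 t) : ℂ)) * ψ t ∂(volume.prod volume) := by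
    intro t
    rw [stftInversion, integral_mul_const, mul_assoc]
  simp_rw [hf]
  refine ⟨hint.integral_prod_right.const_mul _, ?_⟩
  rw [integral_const_mul, eq_inv_mul_iff_mul_eq₀ hc0]
  exact integral_norm_sq_mul_apply_eq hp hs hu ψ

theorem IsContinuousRep.eq {f g : (𝔼 n) → ℂ} (hf : IsContinuousRep u f) (hg : IsContinuousRep u g) :
    f = g := by
  rw [← Continuous.ae_eq_iff_eq volume hf.1 hg.1]
  refine ae_eq_of_integral_contDiff_smul_eq hf.1.locallyIntegrable hg.1.locallyIntegrable
    fun ψ hψ hψ' => ?_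
  have hc : HasCompactSupport (fun t => (ψ t : ℂ)) := hψ'.comp_left Complex.ofReal_zero
  obtain ⟨k, hk⟩ : ∃ k : 𝓢(𝔼 n, ℂ), ∀ t, k t = ψ t :=
    ⟨hc.toSchwartzMap (Complex.ofRealCLM.contDiff.comp hψ), fun t => rfl⟩
  have h := (hf.2 k).2.symm.trans (hg.2 k).2
  simp_rw [hk] at h
  simp_rw [Complex.real_smul, mul_comm (ψ _ : ℂ)]
  exact h

end Inversion

/-! ### Absolutely convergent superpositions of characters -/

section ExpIntegral

open Filter Topology
open scoped NNReal

variable {V : Type*} [NormedAddCommGroup V] [InnerProductSpace ℝ V]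

/-- The character `t ↦ exp (i t · ξ)`. -/
def charExp (ξ t : V) : ℂ := Complex.exp (((inner ℝ t ξ : ℝ) : ℂ) * Complex.I)

@[simp]
theorem norm_charExp (ξ t : V) : ‖charExp ξ t‖ = 1 := Complex.norm_exp_ofReal_mul_I _

@[simp]
theorem enorm_charExp (ξ t : V) : ‖charExp ξ t‖ₑ = 1 := by
  rw [← ofReal_norm, norm_charExp, ENNReal.ofReal_one]

theorem charExp_add (ξ η t : V) : charExp (ξ + η) t = charExp ξ t * charExp η t := by
  rw [charExp, charExp, charExp, ← Complex.exp_add, inner_add_right]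
  push_cast
  ring_nf

theorem charExp_zero (t : V) : charExp 0 t = 1 := by simp [charExp]

theorem continuous_charExp : Continuous fun w : V × V => charExp w.1 w.2 := by
  unfold charExp
  fun_prop

variable [MeasurableSpace V] [BorelSpace V] [SecondCountableTopology V]

/-- The mass of the family of characters with frequency `w.1` and amplitude `w.2`, weighted by the
`s`-th power of the frequency. -/
def expMass (s : ℝ) (μ : Measure (V × ℂ)) : ℝ≥0∞ :=
  ∫⁻ w, ‖w.2‖ₑ * ENNReal.ofReal (polyWeight s w.1) ∂μ

/-- The superposition of characters with frequency `w.1` and amplitude `w.2`. -/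
def expIntegral (μ : Measure (V × ℂ)) (t : V) : ℂ := ∫ w, w.2 * charExp w.1 t ∂μ

theorem measurable_expMass_integrand (s : ℝ) :
    Measurable fun w : V × ℂ => ‖w.2‖ₑ * ENNReal.ofReal (polyWeight s w.1) :=
  measurable_snd.enorm.mul ((continuous_polyWeight s).measurable.comp measurable_fst).ennreal_ofReal

theorem continuous_expIntegral_integrand (t : V) :
    Continuous fun w : V × ℂ => w.2 * charExp w.1 t :=
  continuous_snd.mul (continuous_charExp.comp (continuous_fst.prodMk continuous_const))

theorem expMass_zero_eq (μ : Measure (V × ℂ)) : expMass 0 μ = ∫⁻ w, ‖w.2‖ₑ ∂μ := by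
  simp [expMass, polyWeight]

theorem integrable_expIntegral {μ : Measure (V × ℂ)} (h : expMass 0 μ < ∞) (t : V) :
    Integrable (fun w : V × ℂ => w.2 * charExp w.1 t) μ := by
  refine ⟨(continuous_expIntegral_integrand t).aestronglyMeasurable, ?_⟩
  rw [expMass_zero_eq] at h
  simpa [HasFiniteIntegral, enorm_mul] using h

/-- `f` is a superposition of characters of total mass at most `A` and weighted mass at most `B`. -/
def IsCharSum (s : ℝ) (A B : ℝ≥0) (f : V → ℂ) : Prop :=
  ∃ μ : Measure (V × ℂ), SFinite μ ∧ expMass 0 μ ≤ A ∧ expMass s μ ≤ B ∧ ∀ t, f t = expIntegral μ t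

/-- Any parametrized family of amplitudes and frequencies can be pushed forward to `V × ℂ`. Keeping
the amplitude as a coordinate lets positive measures replace complex ones. -/
theorem IsCharSum.of_integral {s : ℝ} {A B : ℝ≥0} {Ω : Type*} [MeasurableSpace Ω] {ν : Measure Ω}
    [SFinite ν] {c : Ω → ℂ} {θ : Ω → V} (hc : Measurable c) (hθ : Measurable θ)
    (hA : ∫⁻ w, ‖c w‖ₑ ∂ν ≤ A)
    (hB : ∫⁻ w, ‖c w‖ₑ * ENNReal.ofReal (polyWeight s (θ w)) ∂ν ≤ B) {f : V → ℂ}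
    (hf : ∀ t, f t = ∫ w, c w * charExp (θ w) t ∂ν) : IsCharSum s A B f := by
  have hm : Measurable fun w => (θ w, c w) := hθ.prodMk hc
  refine ⟨ν.map fun w => (θ w, c w), inferInstance, ?_, ?_, fun t => ?_⟩
  · rw [expMass_zero_eq, lintegral_map measurable_snd.enorm hm]
    exact hA
  · rw [expMass, lintegral_map (measurable_expMass_integrand s) hm]
    exact hB
  · rw [hf, expIntegral, integral_map hm.aemeasurable
      (continuous_expIntegral_integrand t).aestronglyMeasurable]

theorem IsCharSum.mono {s : ℝ} {A B A' B' : ℝ≥0} {f : V → ℂ} (h : IsCharSum s A B f) (hA : A ≤ A')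
    (hB : B ≤ B') : IsCharSum s A' B' f := by
  obtain ⟨μ, h1, h2, h3, h4⟩ := h
  exact ⟨μ, h1, h2.trans (by exact_mod_cast hA), h3.trans (by exact_mod_cast hB), h4⟩

theorem IsCharSum.norm_le {s : ℝ} {A B : ℝ≥0} {f : V → ℂ} (h : IsCharSum s A B f) (t : V) :
    ‖f t‖ ≤ A := by
  obtain ⟨μ, h1, h2, h3, h4⟩ := h
  rw [h4, ← coe_nnnorm, NNReal.coe_le_coe, ← ENNReal.coe_le_coe, ← enorm_eq_nnnorm]
  refine (enorm_integral_le_lintegral_enorm _).trans ?_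
  rw [expMass_zero_eq] at h2
  simpa [enorm_mul] using h2

theorem IsCharSum.const (s : ℝ) (c : ℂ) : IsCharSum (V := V) s ‖c‖₊ ‖c‖₊ fun _ => c := by
  refine IsCharSum.of_integral (ν := Measure.dirac ()) (c := fun _ => c) (θ := fun _ => 0)
    measurable_const measurable_const ?_ ?_ fun t => ?_
  · simp [enorm_eq_nnnorm]
  · simp [polyWeight, enorm_eq_nnnorm]
  · simp [charExp_zero]

/-- Products of characters add frequencies, so the product measure represents the product. Splitting
the weight as a sum, rather than using submultiplicativity, pairs each weighted mass with an
unweighted one; this keeps `B` to the first power in `IsCharSum.pow`. -/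
theorem IsCharSum.mul {s α β : ℝ} (hα : 0 ≤ α) (hβ : 0 ≤ β)
    (hw : ∀ ξ η : V, polyWeight s (ξ + η) ≤ α * polyWeight s ξ + β * polyWeight s η)
    {A B A' B' : ℝ≥0} {f g : V → ℂ} (hf : IsCharSum s A B f) (hg : IsCharSum s A' B' g) :
    IsCharSum s (A * A') (α.toNNReal * (B * A') + β.toNNReal * (A * B')) fun t => f t * g t := by
  obtain ⟨μ, h1, h2, h3, h4⟩ := hf
  obtain ⟨μ', h1', h2', h3', h4'⟩ := hg
  have hm := measurable_expMass_integrand (V := V) s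
  have hprod : ∀ F G : V × ℂ → ℝ≥0∞, Measurable F → Measurable G →
      ∫⁻ w : (V × ℂ) × (V × ℂ), F w.1 * G w.2 ∂(μ.prod μ') = (∫⁻ w, F w ∂μ) * ∫⁻ w, G w ∂μ' :=
    fun F G hF hG => lintegral_prod_mul hF.aemeasurable hG.aemeasurable
  refine IsCharSum.of_integral (ν := μ.prod μ') (c := fun w => w.1.2 * w.2.2)
    (θ := fun w => w.1.1 + w.2.1) (by fun_prop) (by fun_prop) ?_ ?_ fun t => ?_
  · simp_rw [enorm_mul]
    rw [hprod _ _ measurable_snd.enorm measurable_snd.enorm, ← expMass_zero_eq, ← expMass_zero_eq]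
    push_cast
    gcongr
  · calc ∫⁻ w : (V × ℂ) × (V × ℂ), ‖w.1.2 * w.2.2‖ₑ
          * ENNReal.ofReal (polyWeight s (w.1.1 + w.2.1)) ∂(μ.prod μ')
        ≤ ∫⁻ w : (V × ℂ) × (V × ℂ), (α.toNNReal : ℝ≥0∞)
            * ((‖w.1.2‖ₑ * ENNReal.ofReal (polyWeight s w.1.1)) * ‖w.2.2‖ₑ)
          + (β.toNNReal : ℝ≥0∞)
            * (‖w.1.2‖ₑ * (‖w.2.2‖ₑ * ENNReal.ofReal (polyWeight s w.2.1))) ∂(μ.prod μ') := by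
          refine lintegral_mono fun w => ?_
          have h := ENNReal.ofReal_le_ofReal (hw w.1.1 w.2.1)
          rw [ENNReal.ofReal_add (mul_nonneg hα (polyWeight_pos s _).le)
            (mul_nonneg hβ (polyWeight_pos s _).le), ENNReal.ofReal_mul hα,
            ENNReal.ofReal_mul hβ] at h
          rw [enorm_mul]
          refine (mul_le_mul_right h _).trans (le_of_eq ?_)
          simp only [ENNReal.ofReal]
          ring
      _ = (α.toNNReal : ℝ≥0∞) * (expMass s μ * expMass 0 μ')
          + (β.toNNReal : ℝ≥0∞) * (expMass 0 μ * expMass s μ') := by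
          rw [lintegral_add_left, lintegral_const_mul, lintegral_const_mul,
            hprod _ _ hm measurable_snd.enorm, hprod _ _ measurable_snd.enorm hm,
            ← expMass_zero_eq, ← expMass_zero_eq]
          · rfl
          · exact (measurable_snd.enorm.comp measurable_fst).mul (hm.comp measurable_snd)
          · exact (hm.comp measurable_fst).mul (measurable_snd.enorm.comp measurable_snd)
          · exact ((hm.comp measurable_fst).mul
              (measurable_snd.enorm.comp measurable_snd)).const_mul _
      _ ≤ _ := by
          push_cast
          gcongr
  · rw [h4, h4', expIntegral, expIntegral, ← integral_prod_mul]
    refine integral_congr_ae (Eventually.of_forall fun w => ?_)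
    simp only [charExp_add]
    ring

theorem IsCharSum.const_mul {s : ℝ} {A B : ℝ≥0} {f : V → ℂ} (c : ℂ) (hf : IsCharSum s A B f) :
    IsCharSum s (‖c‖₊ * A) (‖c‖₊ * B) fun t => c * f t := by
  obtain ⟨μ, h1, h2, h3, h4⟩ := hf
  refine IsCharSum.of_integral (ν := μ) (c := fun w => c * w.2) (θ := fun w => w.1) (by fun_prop)
    (by fun_prop) ?_ ?_ fun t => ?_
  · simp_rw [enorm_mul]
    rw [lintegral_const_mul _ measurable_snd.enorm, ← expMass_zero_eq, enorm_eq_nnnorm]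
    push_cast
    gcongr
  · simp_rw [enorm_mul, mul_assoc]
    rw [lintegral_const_mul _ (measurable_expMass_integrand s), enorm_eq_nnnorm]
    push_cast
    gcongr
    exact h3
  · rw [h4, expIntegral, ← integral_const_mul]
    simp_rw [mul_assoc]

/-- The polynomial weight is almost subadditive under adding one further summand. -/
theorem polyWeight_add_le_succ {s : ℝ} (hs : 0 ≤ s) {k : ℕ} (hk : 0 < k) (ξ η : V) :
    polyWeight s (ξ + η) ≤ (((k : ℝ) + 1) / k) ^ ⌈s⌉₊ * polyWeight s ξ
      + ((k : ℝ) + 1) ^ ⌈s⌉₊ * polyWeight s η := by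
  have hk' : (1 : ℝ) ≤ k := by exact_mod_cast hk
  have hmain : ∀ {r : ℝ} {ζ : V}, 1 ≤ r → 1 + ‖ξ + η‖ ≤ r * (1 + ‖ζ‖) →
      polyWeight s (ξ + η) ≤ r ^ ⌈s⌉₊ * polyWeight s ζ := by
    intro r ζ hr h
    unfold polyWeight
    refine (Real.rpow_le_rpow (by positivity) h hs).trans ?_
    rw [Real.mul_rpow (by positivity) (by positivity), ← Real.rpow_natCast]
    have := Real.rpow_le_rpow_of_exponent_le hr (Nat.le_ceil s)
    gcongr
  have h0 : ‖ξ + η‖ ≤ ‖ξ‖ + ‖η‖ := norm_add_le _ _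
  have p1 := polyWeight_pos s ξ
  have p2 := polyWeight_pos s η
  -- Since `1 + ‖ξ + η‖ ≤ (1 + ‖ξ‖) + (1 + ‖η‖)`, the term with `ξ` dominates with ratio `1 + 1/k`,
  -- or else the term with `η` with ratio `k + 1`.
  rcases le_total ((k : ℝ) * (1 + ‖η‖)) (1 + ‖ξ‖) with h | h
  · refine (hmain (r := ((k : ℝ) + 1) / k) (ζ := ξ) ?_ ?_).trans
      (le_add_of_nonneg_right (by positivity))
    · rw [le_div_iff₀ (by positivity)]; linarith
    · rw [div_mul_eq_mul_div, le_div_iff₀ (by positivity)]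
      nlinarith [norm_nonneg ξ, norm_nonneg η]
  · refine (hmain (r := (k : ℝ) + 1) (ζ := η) (by linarith) ?_).trans
      (le_add_of_nonneg_left (by positivity))
    nlinarith [norm_nonneg ξ, norm_nonneg η]

/-- With `σ = ⌈s⌉₊`, the factors `((k + 2) / (k + 1)) ^ σ` telescope over the induction, and each
further factor `f` contributes one more term `(k + 2) ^ σ * A ^ (k + 1) * B`. The total growth is
polynomial in `k` on top of `A ^ k`, so the unweighted mass alone governs convergence of power
series. -/
theorem IsCharSum.pow {s : ℝ} (hs : 0 ≤ s) {A B : ℝ≥0} {f : V → ℂ} (hf : IsCharSum s A B f) (k : ℕ) :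
    IsCharSum s (A ^ (k + 1)) (((k : ℝ≥0) + 1) ^ (⌈s⌉₊ + 1) * (A ^ k * B))
      fun t => f t ^ (k + 1) := by
  induction k with
  | zero => simpa using hf
  | succ k ih =>
    have h := ih.mul (by positivity) (by positivity)
      (polyWeight_add_le_succ hs (k := k + 1) (Nat.succ_pos k)) hf
    simp_rw [← pow_succ] at h
    refine h.mono le_rfl (le_of_eq ?_)
    rw [← NNReal.coe_inj]
    push_cast
    rw [Real.coe_toNNReal _ (by positivity), Real.coe_toNNReal _ (by positivity), div_pow]
    field_simp
    ring

/-- The sum of the representing measures represents the sum of the series. -/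
theorem IsCharSum.hasSum {s : ℝ} {A B : ℕ → ℝ≥0} {f : ℕ → V → ℂ}
    (hf : ∀ k, IsCharSum s (A k) (B k) (f k)) (hA : Summable A) (hB : Summable B) {F : V → ℂ}
    (hF : ∀ t, HasSum (fun k => f k t) (F t)) : IsCharSum s (∑' k, A k) (∑' k, B k) F := by
  choose μ h1 h2 h3 h4 using hf
  have hmass : expMass 0 (Measure.sum μ) ≤ (∑' k, A k : ℝ≥0) := by
    rw [expMass, lintegral_sum_measure, ENNReal.coe_tsum hA]
    exact ENNReal.tsum_le_tsum h2
  refine ⟨Measure.sum μ, inferInstance, hmass, ?_, fun t => ?_⟩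
  · rw [expMass, lintegral_sum_measure, ENNReal.coe_tsum hB]
    exact ENNReal.tsum_le_tsum h3
  · have h := hasSum_integral_measure
      (integrable_expIntegral (hmass.trans_lt ENNReal.coe_lt_top) t)
    refine (hF t).unique ?_
    simp_rw [h4]
    exact h

theorem IsCharSum.add {s : ℝ} {A B A' B' : ℝ≥0} {f g : V → ℂ} (hf : IsCharSum s A B f)
    (hg : IsCharSum s A' B' g) : IsCharSum s (A + A') (B + B') fun t => f t + g t := by
  obtain ⟨μ, h1, h2, h3, h4⟩ := hf
  obtain ⟨μ', h1', h2', h3', h4'⟩ := hg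
  refine ⟨μ + μ', inferInstance, ?_, ?_, fun t => ?_⟩
  · rw [expMass, lintegral_add_measure]
    push_cast
    exact add_le_add h2 h2'
  · rw [expMass, lintegral_add_measure]
    push_cast
    exact add_le_add h3 h3'
  · change f t + g t = _
    rw [h4, h4', expIntegral, expIntegral, expIntegral, integral_add_measure]
    · exact integrable_expIntegral (h2.trans_lt ENNReal.coe_lt_top) t
    · exact integrable_expIntegral (h2'.trans_lt ENNReal.coe_lt_top) t

theorem summable_div_pow {A r₀ : ℝ≥0} (hA : A < r₀) (N : ℕ) :
    Summable fun k : ℕ => (k : ℝ≥0) ^ N * (A / r₀) ^ k := by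
  have hq : ‖((A / r₀ : ℝ≥0) : ℝ)‖ < 1 := by
    rw [NNReal.norm_eq]
    exact_mod_cast (div_lt_one (pos_of_gt hA)).2 hA
  have h := summable_pow_mul_geometric_of_norm_lt_one N hq
  rw [← NNReal.summable_coe]
  push_cast at h ⊢
  exact h

theorem summable_coeff_mul_pow {A r₀ C : ℝ≥0} {c : ℕ → ℝ≥0} (hA : A < r₀)
    (hc : ∀ k, c k ≤ C / r₀ ^ k) : Summable fun k : ℕ => c (k + 1) * A ^ (k + 1) := by
  have h0 : Summable fun k : ℕ => (A / r₀) ^ k := by simpa using summable_div_pow hA 0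
  refine NNReal.summable_of_le (fun k => ?_) (h0.mul_left (C * (A / r₀)))
  refine (mul_le_mul_left (hc (k + 1)) _).trans (le_of_eq ?_)
  rw [mul_assoc, ← pow_succ', div_pow, mul_div_assoc']
  exact div_mul_eq_mul_div _ _ _

theorem summable_coeff_mul_poly_mul_pow {A B r₀ C : ℝ≥0} {c : ℕ → ℝ≥0} (hA : A < r₀)
    (hc : ∀ k, c k ≤ C / r₀ ^ k) (N : ℕ) :
    Summable fun k : ℕ => c (k + 1) * (((k : ℝ≥0) + 1) ^ N * (A ^ k * B)) := by
  have h0 : Summable fun k : ℕ => (A / r₀) ^ k := by simpa using summable_div_pow hA 0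
  have h1 : Summable fun k : ℕ => C / r₀ * B * 2 ^ (N - 1)
      * ((k : ℝ≥0) ^ N * (A / r₀) ^ k + (A / r₀) ^ k) :=
    ((summable_div_pow hA N).add h0).mul_left _
  refine NNReal.summable_of_le (fun k => ?_) h1
  have h2 := add_pow_le (zero_le : (0 : ℝ≥0) ≤ (k : ℝ≥0)) zero_le_one N
  rw [one_pow] at h2
  refine (mul_le_mul' (hc (k + 1)) (mul_le_mul_left h2 _)).trans (le_of_eq ?_)
  have hr0 : 0 < r₀ := pos_of_gt hA
  rw [div_pow, pow_succ]
  field_simp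

theorem FormalMultilinearSeries.exists_nnnorm_coeff_le (P : FormalMultilinearSeries ℂ ℂ ℂ) {r₀ : ℝ≥0}
    (h0 : 0 < r₀) (hr : (r₀ : ℝ≥0∞) < P.radius) :
    ∃ C, ∀ k, ‖P.coeff k‖₊ ≤ C / r₀ ^ k := by
  obtain ⟨C, -, hC⟩ := P.nnnorm_mul_pow_le_of_lt_radius hr
  refine ⟨C, fun k => ?_⟩
  rw [le_div_iff₀ (by positivity)]
  refine le_trans (le_of_eq ?_) (hC k)
  rw [← NNReal.coe_inj]
  simp

/-- Composition with a power series whose radius of convergence exceeds the unweighted mass. -/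
theorem IsCharSum.comp_hasFPowerSeriesOnBall {s : ℝ} (hs : 0 ≤ s) {A B r₀ : ℝ≥0} {h : V → ℂ}
    (hh : IsCharSum s A B h) {F : ℂ → ℂ} {P : FormalMultilinearSeries ℂ ℂ ℂ} {b : ℂ} {r : ℝ≥0∞}
    (hF : HasFPowerSeriesOnBall F P b r) (hr : (r₀ : ℝ≥0∞) < r) (hA : A < r₀) :
    ∃ A' B', IsCharSum s A' B' fun t => F (b + h t) := by
  obtain ⟨C, hco⟩ := P.exists_nnnorm_coeff_le (pos_of_gt hA) (hr.trans_le hF.r_le)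
  -- The power bound is available for exponents at least `1`; the constant coefficient is added at
  -- the end as a multiple of the zero-frequency character.
  have hterm : ∀ k, IsCharSum s (‖P.coeff (k + 1)‖₊ * A ^ (k + 1))
      (‖P.coeff (k + 1)‖₊ * (((k : ℝ≥0) + 1) ^ (⌈s⌉₊ + 1) * (A ^ k * B)))
      fun t => P.coeff (k + 1) * h t ^ (k + 1) := fun k => (hh.pow hs k).const_mul _
  have hSA := summable_coeff_mul_pow hA hco
  have hSB := summable_coeff_mul_poly_mul_pow (B := B) hA hco (⌈s⌉₊ + 1)
  have hsum : ∀ t, HasSum (fun k => P.coeff (k + 1) * h t ^ (k + 1)) (F (b + h t) - P.coeff 0) := by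
    intro t
    have ht : h t ∈ Metric.eball (0 : ℂ) r := by
      rw [Metric.mem_eball, edist_zero_right, enorm_eq_nnnorm]
      refine lt_trans (ENNReal.coe_lt_coe.2 (lt_of_le_of_lt ?_ hA)) hr
      exact_mod_cast hh.norm_le t
    have h1 := hF.hasSum ht
    simp_rw [FormalMultilinearSeries.apply_eq_pow_smul_coeff, smul_eq_mul, mul_comm _ (P.coeff _)]
      at h1
    have h2 := (hasSum_nat_add_iff' 1).2 h1
    simpa using h2
  have h3 := (IsCharSum.hasSum hterm hSA hSB hsum).add (IsCharSum.const s (P.coeff 0))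
  simp_rw [sub_add_cancel] at h3
  exact ⟨_, _, h3⟩

end ExpIntegral

/-! ### Localization of superpositions of characters -/

section Localization

open Filter Topology FourierTransform
open scoped NNReal

variable {n : ℕ}

local notation "𝔼" n => EuclideanSpace ℝ (Fin n)

theorem polyWeight_le_one_add_pow {V : Type*} [NormedAddCommGroup V] (s : ℝ) (ξ : V) :
    polyWeight s ξ ≤ (1 + ‖ξ‖) ^ ⌈s⌉₊ := by
  rw [polyWeight, ← Real.rpow_natCast]
  exact Real.rpow_le_rpow_of_exponent_le (by linarith [norm_nonneg ξ]) (Nat.le_ceil s)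

theorem polyWeight_smul_le {V : Type*} [NormedAddCommGroup V] [NormedSpace ℝ V] {s : ℝ} (hs : 0 ≤ s)
    (r : ℝ) (ξ : V) : polyWeight s (r • ξ) ≤ (1 + |r|) ^ s * polyWeight s ξ := by
  unfold polyWeight
  rw [← Real.mul_rpow (by positivity) (by positivity), norm_smul, Real.norm_eq_abs]
  refine Real.rpow_le_rpow (by positivity) ?_ hs
  nlinarith [norm_nonneg ξ, abs_nonneg r]

theorem inv_pow_mul_polyWeight_le (s : ℝ) (ξ : 𝔼 n) :
    ((1 + ‖ξ‖) ^ ((volume : Measure (𝔼 n)).integrablePower + ⌈s⌉₊))⁻¹ * polyWeight s ξ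
      ≤ decayWeight ξ := by
  rw [decayWeight, pow_add, mul_inv, mul_assoc]
  refine mul_le_of_le_one_right (by positivity) ?_
  rw [inv_mul_le_one₀ (by positivity)]
  exact polyWeight_le_one_add_pow s ξ

theorem fourierChar_inner_eq_charExp (ζ t : 𝔼 n) :
    (Real.fourierChar (inner ℝ ζ t) : ℂ) = charExp ((2 * Real.pi) • ζ) t := by
  rw [Real.fourierChar_apply, charExp, inner_smul_right, real_inner_comm]

theorem charExp_smul {V : Type*} [NormedAddCommGroup V] [InnerProductSpace ℝ V] (r : ℝ) (ξ t : V) :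
    charExp (r • ξ) t = charExp ξ (r • t) := by
  rw [charExp, charExp, inner_smul_right, inner_smul_left]
  simp

theorem charExp_comm {V : Type*} [NormedAddCommGroup V] [InnerProductSpace ℝ V] (ξ t : V) :
    charExp ξ t = charExp t ξ := by
  rw [charExp, charExp, real_inner_comm]

theorem charExp_add_right {V : Type*} [NormedAddCommGroup V] [InnerProductSpace ℝ V] (ξ t t' : V) :
    charExp ξ (t + t') = charExp ξ t * charExp ξ t' := by
  rw [charExp_comm, charExp_add, charExp_comm t, charExp_comm t']

theorem SchwartzMap.eq_integral_fourier (h : 𝓢(𝔼 n, ℂ)) (t : 𝔼 n) :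
    h t = ∫ ζ, 𝓕 h ζ * charExp ((2 * Real.pi) • ζ) t := by
  have h1 : h t = 𝓕⁻ (𝓕 h) t := by rw [FourierTransform.fourierInv_fourier_eq]
  rw [h1, SchwartzMap.fourierInv_coe, Real.fourierInv_eq]
  refine integral_congr_ae (Eventually.of_forall fun ζ => ?_)
  simp only
  rw [Circle.smul_def, fourierChar_inner_eq_charExp, smul_eq_mul, mul_comm]

/-- The weight is at least `1`, so finite weighted mass implies finite unweighted mass. The
unweighted bound is kept explicit because its smallness is needed later; the weighted one only has
to exist. -/
theorem IsCharSum.exists_of_integrable {V : Type*} [NormedAddCommGroup V] [InnerProductSpace ℝ V]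
    [MeasurableSpace V] [BorelSpace V] [SecondCountableTopology V] {s : ℝ} (hs : 0 ≤ s)
    {Ω : Type*} [MeasurableSpace Ω] {ν : Measure Ω}
    [SFinite ν] {c : Ω → ℂ} {θ : Ω → V} (hc : Measurable c) (hθ : Measurable θ)
    (h : ∫⁻ w, ‖c w‖ₑ * ENNReal.ofReal (polyWeight s (θ w)) ∂ν < ∞) {f : V → ℂ}
    (hf : ∀ t, f t = ∫ w, c w * charExp (θ w) t ∂ν) :
    ∃ B, IsCharSum s (∫⁻ w, ‖c w‖ₑ ∂ν).toNNReal B f := by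
  have h1 : ∫⁻ w, ‖c w‖ₑ ∂ν < ∞ := by
    refine lt_of_le_of_lt (lintegral_mono fun w => ?_) h
    refine le_mul_of_one_le_right zero_le ?_
    rw [← ENNReal.ofReal_one]
    exact ENNReal.ofReal_le_ofReal (one_le_polyWeight hs _)
  refine ⟨_, IsCharSum.of_integral hc hθ ?_ (ENNReal.coe_toNNReal h.ne).ge hf⟩
  exact (ENNReal.coe_toNNReal h1.ne).ge

/-! ### Schwartz cutoffs of elements of a modulation space -/

section Product

variable {p : ℝ≥0∞} {s : ℝ} {φ : 𝓢(𝔼 n, ℂ)} {u : 𝓢'(𝔼 n, ℂ)}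

theorem integrable_stft_mul_fourier_slice (hp : 1 ≤ p) (hs : 0 ≤ s)
    (hu : u ∈ modulationSpace φ p 1 s) (Θ : 𝓢((𝔼 n) × (𝔼 n), ℂ)) :
    Integrable (fun w : ((𝔼 n) × (𝔼 n)) × (𝔼 n) => ‖stft φ u w.1.1 ((2 * Real.pi) • w.1.2)
      * 𝓕 (Θ.slice w.1.1) w.2‖ * polyWeight s ((2 * Real.pi) • (w.1.2 + w.2)))
      ((volume.prod volume).prod volume) := by
  obtain ⟨C, hC, h⟩ := Θ.exists_fourier_slice_le_decayWeight
    ((volume : Measure (𝔼 n)).integrablePower + ⌈s⌉₊)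
  set M := (volume : Measure (𝔼 n)).integrablePower + ⌈s⌉₊
  have h1 := (integrable_stft_mul_weights hp hs φ u hu).mul_prod (ν := volume)
    ((integrable_decayWeight (V := 𝔼 n)).const_mul (C * (1 + |2 * Real.pi|) ^ s))
  have hV := (continuous_stft_smul φ u).comp (continuous_fst (X := (𝔼 n) × (𝔼 n)) (Y := 𝔼 n))
  have hΘ := Θ.continuous_fourier_slice.comp
    ((continuous_fst.comp continuous_fst).prodMk (continuous_snd (X := (𝔼 n) × (𝔼 n)) (Y := 𝔼 n)))
  have hW := (continuous_polyWeight (V := 𝔼 n) s).comp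
    (by fun_prop : Continuous fun w : ((𝔼 n) × (𝔼 n)) × (𝔼 n) => (2 * Real.pi) • (w.1.2 + w.2))
  refine h1.mono' ((hV.mul hΘ).norm.mul hW).aestronglyMeasurable (Eventually.of_forall fun w => ?_)
  have p1 := polyWeight_pos s ((2 * Real.pi) • w.1.2)
  have p2 := polyWeight_pos s w.2
  have p3 := polyWeight_pos s ((2 * Real.pi) • (w.1.2 + w.2))
  have p4 := decayWeight_pos w.1.1
  rw [Real.norm_of_nonneg (by positivity), norm_mul]
  calc ‖stft φ u w.1.1 ((2 * Real.pi) • w.1.2)‖ * ‖𝓕 (Θ.slice w.1.1) w.2‖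
        * polyWeight s ((2 * Real.pi) • (w.1.2 + w.2))
      ≤ ‖stft φ u w.1.1 ((2 * Real.pi) • w.1.2)‖ * (C * decayWeight w.1.1 * ((1 + ‖w.2‖) ^ M)⁻¹)
        * (polyWeight s ((2 * Real.pi) • w.1.2) * ((1 + |2 * Real.pi|) ^ s * polyWeight s w.2)) := by
        gcongr
        · exact h _ _
        · rw [smul_add]
          refine (polyWeight_add_le hs _ _).trans ?_
          gcongr
          exact polyWeight_smul_le hs _ _
    _ = ‖stft φ u w.1.1 ((2 * Real.pi) • w.1.2)‖ * (decayWeight w.1.1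
        * polyWeight s ((2 * Real.pi) • w.1.2)) * (C * (1 + |2 * Real.pi|) ^ s
        * (((1 + ‖w.2‖) ^ M)⁻¹ * polyWeight s w.2)) := by ring
    _ ≤ _ := by
        gcongr
        exact inv_pow_mul_polyWeight_le s w.2

/-- The product of a Schwartz function and an element of a modulation space is an absolutely
convergent superposition of characters. -/
theorem exists_isCharSum_mul_stftInversion (hp : 1 ≤ p) (hs : 0 ≤ s)
    (hu : u ∈ modulationSpace φ p 1 s) (χ : 𝓢(𝔼 n, ℂ)) :
    ∃ A B, IsCharSum s A B fun t => χ t * stftInversion φ u t := by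
  have hint := integrable_stft_mul_fourier_slice hp hs hu (χ.mulShift φ)
  have hV := (continuous_stft_smul φ u).comp (continuous_fst (X := (𝔼 n) × (𝔼 n)) (Y := 𝔼 n))
  have hΘ := (χ.mulShift φ).continuous_fourier_slice.comp
    ((continuous_fst.comp continuous_fst).prodMk (continuous_snd (X := (𝔼 n) × (𝔼 n)) (Y := 𝔼 n)))
  have hc := hV.mul hΘ
  have hθ : Continuous fun w : ((𝔼 n) × (𝔼 n)) × (𝔼 n) => (2 * Real.pi) • (w.1.2 + w.2) := by
    fun_prop
  have hfin : ∫⁻ w : ((𝔼 n) × (𝔼 n)) × (𝔼 n), ‖stft φ u w.1.1 ((2 * Real.pi) • w.1.2)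
      * 𝓕 ((χ.mulShift φ).slice w.1.1) w.2‖ₑ
      * ENNReal.ofReal (polyWeight s ((2 * Real.pi) • (w.1.2 + w.2)))
      ∂((volume.prod volume).prod volume) < ∞ := by
    refine lt_of_le_of_lt (le_of_eq (lintegral_congr fun w => ?_)) hint.2
    rw [enorm_mul _ (polyWeight s _), enorm_norm, Real.enorm_of_nonneg (polyWeight_pos s _).le]
  -- In the inversion formula, `χ(t) φ(t - x)` is expanded by Fourier inversion in `t` with
  -- frequency variable `ζ`; together with the character at `η` this gives the frequency `2π (η +
  -- ζ)`.
  obtain ⟨B, hB⟩ := IsCharSum.exists_of_integrable hs hc.measurable hθ.measurable hfin (f := fun t =>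
    ∫ w : ((𝔼 n) × (𝔼 n)) × (𝔼 n), stft φ u w.1.1 ((2 * Real.pi) • w.1.2)
      * 𝓕 ((χ.mulShift φ).slice w.1.1) w.2 * charExp ((2 * Real.pi) • (w.1.2 + w.2)) t
      ∂((volume.prod volume).prod volume)) (fun t => rfl)
  have hB' := hB.const_mul (∫ y, ((‖φ y‖ ^ 2 : ℝ) : ℂ))⁻¹
  refine ⟨_, _, Eq.subst (motive := IsCharSum s _ _) ?_ hB'⟩
  funext t
  symm
  rw [stftInversion, mul_left_comm]
  congr 1
  have hi : Integrable (fun w : ((𝔼 n) × (𝔼 n)) × (𝔼 n) => stft φ u w.1.1 ((2 * Real.pi) • w.1.2)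
      * 𝓕 ((χ.mulShift φ).slice w.1.1) w.2 * charExp ((2 * Real.pi) • (w.1.2 + w.2)) t)
      ((volume.prod volume).prod volume) := by
    refine hint.mono' (hc.mul (continuous_charExp.comp
      (hθ.prodMk continuous_const))).aestronglyMeasurable (Eventually.of_forall fun w => ?_)
    rw [norm_mul _ (charExp _ _), norm_charExp]
    exact mul_le_mul_of_nonneg_left (one_le_polyWeight hs _) (norm_nonneg _)
  rw [integral_prod _ hi, ← integral_const_mul]
  refine integral_congr_ae (Eventually.of_forall fun z => ?_)
  have h1 := ((χ.mulShift φ).slice z.1).eq_integral_fourier t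
  rw [SchwartzMap.slice_apply, SchwartzMap.mulShift_apply] at h1
  simp only [smul_add, charExp_add]
  rw [fourierChar_inner_eq_charExp]
  calc χ t * (stft φ u z.1 ((2 * Real.pi) • z.2) * (φ (t - z.1) * charExp ((2 * Real.pi) • z.2) t))
      = stft φ u z.1 ((2 * Real.pi) • z.2) * charExp ((2 * Real.pi) • z.2) t
        * (χ t * φ (t - z.1)) := by ring
    _ = _ := by
      rw [h1, ← integral_const_mul]
      refine integral_congr_ae (Eventually.of_forall fun ζ => ?_)
      ring

end Product

/-! ### Translation estimates in `L¹` -/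

section Smallness

/-- The `L¹` modulus of continuity under translations. -/
def translationModulus (g : 𝓢(𝔼 n, ℂ)) (v : 𝔼 n) : ℝ≥0∞ := ∫⁻ ζ, ‖g (ζ - v) - g ζ‖ₑ

theorem measurable_translationModulus (g : 𝓢(𝔼 n, ℂ)) : Measurable (translationModulus g) := by
  refine Measurable.lintegral_prod_right'
    (f := fun z : (𝔼 n) × (𝔼 n) => ‖g (z.2 - z.1) - g z.2‖ₑ) ?_
  have : Continuous fun z : (𝔼 n) × (𝔼 n) => g (z.2 - z.1) - g z.2 := by fun_prop
  exact this.measurable.enorm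

theorem translationModulus_le (g : 𝓢(𝔼 n, ℂ)) (v : 𝔼 n) :
    translationModulus g v ≤ 2 * ∫⁻ ζ, ‖g ζ‖ₑ := by
  refine (lintegral_mono fun ζ => enorm_sub_le).trans ?_
  rw [lintegral_add_right _ g.continuous.measurable.enorm,
    lintegral_sub_right_eq_self (fun ζ => ‖g ζ‖ₑ), two_mul]

theorem tendsto_translationModulus (g : 𝓢(𝔼 n, ℂ)) :
    Tendsto (translationModulus g) (𝓝 0) (𝓝 0) := by
  obtain ⟨C, hC, h⟩ := g.exists_norm_le_decayWeight
  set N := (volume : Measure (𝔼 n)).integrablePower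
  have key : Tendsto (translationModulus g) (𝓝 0) (𝓝 (∫⁻ _ : 𝔼 n, 0)) := by
    refine tendsto_lintegral_filter_of_dominated_convergence
      (fun ζ => ENNReal.ofReal (C * 2 ^ N * decayWeight ζ + C * decayWeight ζ)) ?_ ?_ ?_ ?_
    · refine Eventually.of_forall fun v => ?_
      have : Continuous fun ζ => g (ζ - v) - g ζ := by fun_prop
      exact this.measurable.enorm
    · filter_upwards [Metric.ball_mem_nhds (0 : 𝔼 n) one_pos] with v hv
      refine Eventually.of_forall fun ζ => ?_
      rw [← ofReal_norm]
      refine ENNReal.ofReal_le_ofReal ((norm_sub_le _ _).trans (add_le_add ?_ (h ζ)))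
      refine (h _).trans ?_
      rw [mul_assoc]
      refine mul_le_mul_of_nonneg_left ?_ hC
      have h1 : decayWeight (ζ - v) = decayWeight (v - ζ) := by
        unfold decayWeight; rw [norm_sub_rev]
      rw [h1]
      refine (decayWeight_sub_le v ζ).trans ?_
      have hv' : 1 + ‖v‖ ≤ 2 := by
        rw [mem_ball_zero_iff] at hv; linarith
      have := decayWeight_pos ζ
      gcongr
    · exact ((integrable_decayWeight.const_mul _).add
        (integrable_decayWeight.const_mul _)).lintegral_lt_top.ne
    · refine Eventually.of_forall fun ζ => ?_
      have hc : Continuous fun v => ‖g (ζ - v) - g ζ‖ₑ := by fun_prop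
      simpa using hc.tendsto 0
  simpa using key

theorem lintegral_translation_mul_polyWeight_le {s : ℝ} (hs : 0 ≤ s) (g : 𝓢(𝔼 n, ℂ)) (v : 𝔼 n) :
    ∫⁻ ζ, ‖g (ζ - v) - g ζ‖ₑ * ENNReal.ofReal (polyWeight s ζ)
      ≤ 2 * ENNReal.ofReal (polyWeight s v)
        * ∫⁻ ζ, ‖g ζ‖ₑ * ENNReal.ofReal (polyWeight s ζ) := by
  have hm : Measurable fun ζ => ‖g ζ‖ₑ * ENNReal.ofReal (polyWeight s ζ) :=
    g.continuous.measurable.enorm.mul (continuous_polyWeight s).measurable.ennreal_ofReal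
  have hm' : Measurable fun ζ => ‖g (ζ - v)‖ₑ * ENNReal.ofReal (polyWeight s (ζ - v)) :=
    hm.comp (measurable_id.sub_const v)
  have h1 : (1 : ℝ≥0∞) ≤ ENNReal.ofReal (polyWeight s v) := by
    rw [← ENNReal.ofReal_one]
    exact ENNReal.ofReal_le_ofReal (one_le_polyWeight hs _)
  calc ∫⁻ ζ, ‖g (ζ - v) - g ζ‖ₑ * ENNReal.ofReal (polyWeight s ζ)
      ≤ ∫⁻ ζ, ENNReal.ofReal (polyWeight s v)
          * (‖g (ζ - v)‖ₑ * ENNReal.ofReal (polyWeight s (ζ - v)))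
        + ENNReal.ofReal (polyWeight s v) * (‖g ζ‖ₑ * ENNReal.ofReal (polyWeight s ζ)) := by
        refine lintegral_mono fun ζ => ?_
        refine (mul_le_mul_left enorm_sub_le _).trans ?_
        rw [add_mul]
        refine add_le_add ?_ (le_mul_of_one_le_left zero_le h1)
        have h2 := polyWeight_add_le hs v (ζ - v)
        rw [add_sub_cancel] at h2
        have h3 := ENNReal.ofReal_le_ofReal h2
        rw [ENNReal.ofReal_mul (polyWeight_pos s _).le] at h3
        refine (mul_le_mul_right h3 _).trans (le_of_eq ?_)
        ring
    _ = _ := by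
        rw [lintegral_add_right _ (hm.const_mul _), lintegral_const_mul _ hm,
          lintegral_const_mul _ hm',
          lintegral_sub_right_eq_self (fun ζ => ‖g ζ‖ₑ * ENNReal.ofReal (polyWeight s ζ))]
        ring

theorem SchwartzMap.lintegral_enorm_mul_polyWeight_lt_top (g : 𝓢(𝔼 n, ℂ)) (s : ℝ) :
    ∫⁻ ζ, ‖g ζ‖ₑ * ENNReal.ofReal (polyWeight s ζ) < ∞ := by
  obtain ⟨C, hC, h⟩ := g.exists_one_add_pow_mul_le
    ((volume : Measure (𝔼 n)).integrablePower + ⌈s⌉₊)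
  have hlt : ∫⁻ ζ : 𝔼 n, ENNReal.ofReal (C * decayWeight ζ) < ∞ :=
    ((integrable_decayWeight (V := 𝔼 n)).const_mul C).lintegral_lt_top
  refine lt_of_le_of_lt (lintegral_mono fun ζ => ?_) hlt
  rw [← ofReal_norm, ← ENNReal.ofReal_mul (norm_nonneg _)]
  refine ENNReal.ofReal_le_ofReal ?_
  have h1 : ‖g ζ‖ ≤ C * ((1 + ‖ζ‖) ^ ((volume : Measure (𝔼 n)).integrablePower + ⌈s⌉₊))⁻¹ := by
    rw [← div_eq_mul_inv, le_div_iff₀' (by positivity)]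
    exact h ζ
  refine (mul_le_mul_of_nonneg_right h1 (polyWeight_pos s ζ).le).trans ?_
  rw [mul_assoc]
  exact mul_le_mul_of_nonneg_left (inv_pow_mul_polyWeight_le s ζ) hC

/-- Translating the Fourier transform multiplies the function by a character. Thus `τ` times the
increment of a character has amplitude `g (ζ - v) - g ζ`, small in `L¹` for small `v`. -/
theorem integral_translation_sub_mul_charExp {τ g : (𝔼 n) → ℂ} (hg : Integrable g)
    (hτ : ∀ t, τ t = ∫ ζ, g ζ * charExp ((2 * Real.pi) • ζ) t) (v y : 𝔼 n) :
    ∫ ζ, (g (ζ - v) - g ζ) * charExp ((2 * Real.pi) • ζ) y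
      = τ y * (charExp ((2 * Real.pi) • v) y - 1) := by
  have hc : Continuous fun ζ : 𝔼 n => charExp ((2 * Real.pi) • ζ) y :=
    (continuous_charExp (V := 𝔼 n)).comp
      ((continuous_const_smul (2 * Real.pi)).prodMk continuous_const)
  have hi : Integrable fun ζ => g ζ * charExp ((2 * Real.pi) • ζ) y := by
    refine hg.norm.mono' (hg.aestronglyMeasurable.mul hc.aestronglyMeasurable)
      (Eventually.of_forall fun ζ => ?_)
    rw [norm_mul, norm_charExp ((2 * Real.pi) • ζ) y, mul_one]
  have e : ∀ ζ, g (ζ - v) * charExp ((2 * Real.pi) • ζ) y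
      = charExp ((2 * Real.pi) • v) y
        * (g (ζ - v) * charExp ((2 * Real.pi) • (ζ - v)) y) := by
    intro ζ
    have : charExp ((2 * Real.pi) • ζ) y
        = charExp ((2 * Real.pi) • v) y * charExp ((2 * Real.pi) • (ζ - v)) y := by
      rw [← charExp_add, ← smul_add, add_sub_cancel]
    rw [this]
    ring
  have hi' : Integrable fun ζ => g (ζ - v) * charExp ((2 * Real.pi) • ζ) y := by
    simp_rw [e]
    exact (hi.comp_sub_right v).const_mul _
  simp_rw [sub_mul]
  rw [integral_sub hi' hi, ← hτ y]
  simp_rw [e]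
  rw [integral_const_mul,
    integral_sub_right_eq_self (fun ζ => g ζ * charExp ((2 * Real.pi) • ζ) y), ← hτ y]
  ring

end Smallness

end Localization

/-! ### Local smallness of increments and local functional calculus -/

section LocalSmallness

open Filter Topology FourierTransform
open scoped NNReal

variable {n : ℕ}

local notation "𝔼" n => EuclideanSpace ℝ (Fin n)

theorem Continuous.charExp {X V : Type*} [TopologicalSpace X] [NormedAddCommGroup V]
    [InnerProductSpace ℝ V] {f g : X → V} (hf : Continuous f) (hg : Continuous g) :
    Continuous fun x => charExp (f x) (g x) :=
  continuous_charExp.comp (hf.prodMk hg)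

/-- The amplitude, as a superposition of characters, of the product of an increment of a
superposition of characters and a dilated cutoff function with Fourier transform `g`. -/
def cutoffAmplitude (g : 𝓢(𝔼 n, ℂ)) (δ : ℝ) (a : 𝔼 n) (w : ((𝔼 n) × ℂ) × (𝔼 n)) : ℂ :=
  w.1.2 * charExp w.1.1 a * charExp ((2 * Real.pi) • w.2) (-(δ⁻¹ • a))
    * (g (w.2 - (δ / (2 * Real.pi)) • w.1.1) - g w.2)

theorem continuous_cutoffAmplitude (g : 𝓢(𝔼 n, ℂ)) (δ : ℝ) (a : 𝔼 n) :
    Continuous (cutoffAmplitude g δ a) := by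
  have h1 : Continuous fun w : ((𝔼 n) × ℂ) × (𝔼 n) => charExp w.1.1 a :=
    (continuous_charExp (V := 𝔼 n)).comp
      ((continuous_fst.comp continuous_fst).prodMk continuous_const)
  have h0 : Continuous fun w : ((𝔼 n) × ℂ) × (𝔼 n) => (2 * Real.pi) • w.2 :=
    (continuous_const_smul (2 * Real.pi)).comp continuous_snd
  have h2 : Continuous fun w : ((𝔼 n) × ℂ) × (𝔼 n) =>
      charExp ((2 * Real.pi) • w.2) (-(δ⁻¹ • a)) :=
    h0.charExp continuous_const
  have h3 : Continuous fun w : ((𝔼 n) × ℂ) × (𝔼 n) =>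
      g (w.2 - (δ / (2 * Real.pi)) • w.1.1) - g w.2 := by fun_prop
  have h4 : Continuous fun w : ((𝔼 n) × ℂ) × (𝔼 n) => w.1.2 := by fun_prop
  exact ((h4.mul h1).mul h2).mul h3

theorem enorm_cutoffAmplitude (g : 𝓢(𝔼 n, ℂ)) (δ : ℝ) (a : 𝔼 n) (w : ((𝔼 n) × ℂ) × (𝔼 n)) :
    ‖cutoffAmplitude g δ a w‖ₑ
      = ‖w.1.2‖ₑ * ‖g (w.2 - (δ / (2 * Real.pi)) • w.1.1) - g w.2‖ₑ := by
  simp only [cutoffAmplitude, enorm_mul, enorm_charExp, mul_one]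

theorem lintegral_enorm_cutoffAmplitude (g : 𝓢(𝔼 n, ℂ)) (δ : ℝ) (a : 𝔼 n)
    (μ : Measure ((𝔼 n) × ℂ)) [SFinite μ] :
    ∫⁻ w, ‖cutoffAmplitude g δ a w‖ₑ ∂(μ.prod volume)
      = ∫⁻ w, ‖w.2‖ₑ * translationModulus g ((δ / (2 * Real.pi)) • w.1) ∂μ := by
  rw [lintegral_prod _ (continuous_cutoffAmplitude g δ a).measurable.enorm.aemeasurable]
  refine lintegral_congr fun w => ?_
  simp_rw [enorm_cutoffAmplitude]
  have hm : Measurable fun ζ : 𝔼 n => ‖g (ζ - (δ / (2 * Real.pi)) • w.1) - g ζ‖ₑ := by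
    have : Continuous fun ζ : 𝔼 n => g (ζ - (δ / (2 * Real.pi)) • w.1) - g ζ := by fun_prop
    exact this.measurable.enorm
  rw [lintegral_const_mul _ hm]
  rfl

theorem lintegral_cutoffAmplitude_lt_top {s : ℝ} (hs : 0 ≤ s) (g : 𝓢(𝔼 n, ℂ)) (δ : ℝ) (a : 𝔼 n)
    (μ : Measure ((𝔼 n) × ℂ)) [SFinite μ] (hμ : expMass s μ < ∞) :
    ∫⁻ w, ‖cutoffAmplitude g δ a w‖ₑ * ENNReal.ofReal (polyWeight s ((δ⁻¹ * (2 * Real.pi)) • w.2))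
      ∂(μ.prod volume) < ∞ := by
  have hm : Measurable fun w : ((𝔼 n) × ℂ) × (𝔼 n) => ‖cutoffAmplitude g δ a w‖ₑ
      * ENNReal.ofReal (polyWeight s ((δ⁻¹ * (2 * Real.pi)) • w.2)) := by
    refine (continuous_cutoffAmplitude g δ a).measurable.enorm.mul (Continuous.measurable ?_).ennreal_ofReal
    exact (continuous_polyWeight s).comp (continuous_snd.const_smul (δ⁻¹ * (2 * Real.pi)))
  rw [lintegral_prod _ hm.aemeasurable]
  set I := ∫⁻ ζ, ‖g ζ‖ₑ * ENNReal.ofReal (polyWeight s ζ) with hI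
  have hI' : I < ∞ := g.lintegral_enorm_mul_polyWeight_lt_top s
  set K := ENNReal.ofReal ((1 + |δ⁻¹ * (2 * Real.pi)|) ^ s)
  set K' := ENNReal.ofReal ((1 + |δ / (2 * Real.pi)|) ^ s)
  have hK : ∀ ζ : 𝔼 n, ENNReal.ofReal (polyWeight s ((δ⁻¹ * (2 * Real.pi)) • ζ))
      ≤ K * ENNReal.ofReal (polyWeight s ζ) := fun ζ => by
    rw [← ENNReal.ofReal_mul (by positivity)]
    exact ENNReal.ofReal_le_ofReal (polyWeight_smul_le hs _ _)
  have hK' : ∀ ζ : 𝔼 n, ENNReal.ofReal (polyWeight s ((δ / (2 * Real.pi)) • ζ))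
      ≤ K' * ENNReal.ofReal (polyWeight s ζ) := fun ζ => by
    rw [← ENNReal.ofReal_mul (by positivity)]
    exact ENNReal.ofReal_le_ofReal (polyWeight_smul_le hs _ _)
  have hbound : ∀ w : (𝔼 n) × ℂ, ∫⁻ ζ, ‖cutoffAmplitude g δ a (w, ζ)‖ₑ
      * ENNReal.ofReal (polyWeight s ((δ⁻¹ * (2 * Real.pi)) • ζ))
      ≤ (K * 2 * K' * I) * (‖w.2‖ₑ * ENNReal.ofReal (polyWeight s w.1)) := by
    intro w
    have hmw : Measurable fun ζ : 𝔼 n => ‖g (ζ - (δ / (2 * Real.pi)) • w.1) - g ζ‖ₑ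
        * ENNReal.ofReal (polyWeight s ζ) := by
      have : Continuous fun ζ : 𝔼 n => g (ζ - (δ / (2 * Real.pi)) • w.1) - g ζ := by fun_prop
      exact this.measurable.enorm.mul (continuous_polyWeight s).measurable.ennreal_ofReal
    calc ∫⁻ ζ, ‖cutoffAmplitude g δ a (w, ζ)‖ₑ
          * ENNReal.ofReal (polyWeight s ((δ⁻¹ * (2 * Real.pi)) • ζ))
        ≤ ∫⁻ ζ, (K * ‖w.2‖ₑ) * (‖g (ζ - (δ / (2 * Real.pi)) • w.1) - g ζ‖ₑ
          * ENNReal.ofReal (polyWeight s ζ)) := by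
          refine lintegral_mono fun ζ => ?_
          rw [enorm_cutoffAmplitude]
          refine (mul_le_mul_right (hK ζ) _).trans (le_of_eq ?_)
          ring
      _ = (K * ‖w.2‖ₑ) * ∫⁻ ζ, ‖g (ζ - (δ / (2 * Real.pi)) • w.1) - g ζ‖ₑ
          * ENNReal.ofReal (polyWeight s ζ) := lintegral_const_mul _ hmw
      _ ≤ (K * ‖w.2‖ₑ) * (2 * (K' * ENNReal.ofReal (polyWeight s w.1)) * I) := by
          refine mul_le_mul_right ((lintegral_translation_mul_polyWeight_le hs g _).trans ?_) _
          gcongr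
          exact hK' _
      _ = _ := by ring
  refine (lintegral_mono hbound).trans_lt ?_
  rw [lintegral_const_mul _ (measurable_expMass_integrand s)]
  have h1 : K < ∞ := ENNReal.ofReal_lt_top
  have h2 : K' < ∞ := ENNReal.ofReal_lt_top
  exact ENNReal.mul_lt_top (ENNReal.mul_lt_top (ENNReal.mul_lt_top
    (ENNReal.mul_lt_top h1 (by simp)) h2) hI') hμ

theorem integral_cutoffAmplitude {τ : (𝔼 n) → ℂ} {g : 𝓢(𝔼 n, ℂ)}
    (hτ : ∀ t, τ t = ∫ ζ, g ζ * charExp ((2 * Real.pi) • ζ) t) {δ : ℝ} (hδ : δ ≠ 0) (a t : 𝔼 n)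
    (w : (𝔼 n) × ℂ) :
    ∫ ζ, cutoffAmplitude g δ a (w, ζ) * charExp ((δ⁻¹ * (2 * Real.pi)) • ζ) t
      = τ (δ⁻¹ • (t - a)) * (w.2 * charExp w.1 t - w.2 * charExp w.1 a) := by
  have h := integral_translation_sub_mul_charExp g.integrable hτ ((δ / (2 * Real.pi)) • w.1)
    (δ⁻¹ • (t - a))
  have e1 : (2 * Real.pi) • (δ / (2 * Real.pi)) • w.1 = δ • w.1 := by
    rw [smul_smul]; congr 1; field_simp
  have e2 : charExp (δ • w.1) (δ⁻¹ • (t - a)) * charExp w.1 a = charExp w.1 t := by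
    rw [charExp_smul, smul_inv_smul₀ hδ, ← charExp_add_right, sub_add_cancel]
  rw [e1] at h
  have e3 : ∀ ζ : 𝔼 n, cutoffAmplitude g δ a (w, ζ) * charExp ((δ⁻¹ * (2 * Real.pi)) • ζ) t
      = w.2 * charExp w.1 a * ((g (ζ - (δ / (2 * Real.pi)) • w.1) - g ζ)
        * charExp ((2 * Real.pi) • ζ) (δ⁻¹ • (t - a))) := by
    intro ζ
    rw [mul_smul, charExp_smul δ⁻¹, smul_sub, sub_eq_add_neg (δ⁻¹ • t), charExp_add_right,
      cutoffAmplitude]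
    ring
  simp_rw [e3]
  rw [integral_const_mul, h, ← e2]
  ring

/-- In the variable `y = (t - a)/δ`, the increment of the character `ξ` between `a` and `t` is a
unimodular constant times `exp (i δ y · ξ) - 1`, so multiplication by `τ y` translates `g` by `δ ξ /
(2π)`. The mass is the average of the translation moduli. -/
theorem IsCharSum.exists_cutoff {s : ℝ} (hs : 0 ≤ s) {τ : (𝔼 n) → ℂ} {g : 𝓢(𝔼 n, ℂ)}
    (hτ : ∀ t, τ t = ∫ ζ, g ζ * charExp ((2 * Real.pi) • ζ) t) {δ : ℝ} (hδ : δ ≠ 0) (a : 𝔼 n)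
    (μ : Measure ((𝔼 n) × ℂ)) [SFinite μ] (h0 : expMass 0 μ < ∞) (hμ : expMass s μ < ∞) :
    ∃ B, IsCharSum s
      (∫⁻ w, ‖w.2‖ₑ * translationModulus g ((δ / (2 * Real.pi)) • w.1) ∂μ).toNNReal B
      fun t => τ (δ⁻¹ • (t - a)) * (expIntegral μ t - expIntegral μ a) := by
  have hθ : Continuous fun w : ((𝔼 n) × ℂ) × (𝔼 n) => (δ⁻¹ * (2 * Real.pi)) • w.2 :=
    continuous_snd.const_smul (δ⁻¹ * (2 * Real.pi))
  have hc := continuous_cutoffAmplitude g δ a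
  have hfin := lintegral_cutoffAmplitude_lt_top hs g δ a μ hμ
  rw [← lintegral_enorm_cutoffAmplitude g δ a μ]
  refine IsCharSum.exists_of_integrable hs hc.measurable hθ.measurable hfin fun t => ?_
  have hi : Integrable (fun w : ((𝔼 n) × ℂ) × (𝔼 n) => cutoffAmplitude g δ a w
      * charExp ((δ⁻¹ * (2 * Real.pi)) • w.2) t) (μ.prod volume) := by
    refine ⟨(hc.mul ((continuous_charExp (V := 𝔼 n)).comp
      (hθ.prodMk continuous_const))).aestronglyMeasurable, (lintegral_mono fun w => ?_).trans_lt hfin⟩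
    rw [enorm_mul, enorm_charExp]
    refine mul_le_mul_right ?_ _
    rw [← ENNReal.ofReal_one]
    exact ENNReal.ofReal_le_ofReal (one_le_polyWeight hs _)
  rw [integral_prod _ hi]
  simp only [integral_cutoffAmplitude hτ hδ a t]
  rw [integral_const_mul, integral_sub (integrable_expIntegral h0 t) (integrable_expIntegral h0 a)]
  rfl

/-- Dominated convergence: each modulus tends to `0` and is at most twice the `L¹` norm of `g`,
while the amplitudes are integrable for `μ`. No uniformity in the frequency is needed. -/
theorem tendsto_lintegral_translationModulus (g : 𝓢(𝔼 n, ℂ)) (μ : Measure ((𝔼 n) × ℂ))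
    (h0 : expMass 0 μ < ∞) :
    Tendsto (fun δ : ℝ => ∫⁻ w, ‖w.2‖ₑ * translationModulus g ((δ / (2 * Real.pi)) • w.1) ∂μ)
      (𝓝 0) (𝓝 0) := by
  have hg : ∫⁻ ζ, ‖g ζ‖ₑ < ∞ := g.integrable.2
  rw [expMass_zero_eq] at h0
  have key : Tendsto
      (fun δ : ℝ => ∫⁻ w, ‖w.2‖ₑ * translationModulus g ((δ / (2 * Real.pi)) • w.1) ∂μ)
      (𝓝 0) (𝓝 (∫⁻ _, 0 ∂μ)) := by
    refine tendsto_lintegral_filter_of_dominated_convergence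
      (fun w => ‖w.2‖ₑ * (2 * ∫⁻ ζ, ‖g ζ‖ₑ)) ?_ ?_ ?_ ?_
    · refine Eventually.of_forall fun δ => ?_
      refine measurable_snd.enorm.mul ((measurable_translationModulus g).comp ?_)
      exact (continuous_fst.const_smul (δ / (2 * Real.pi))).measurable
    · exact Eventually.of_forall fun δ => Eventually.of_forall fun w =>
        mul_le_mul_right (translationModulus_le g _) _
    · rw [lintegral_mul_const _ measurable_snd.enorm]
      exact (ENNReal.mul_lt_top h0 (ENNReal.mul_lt_top (by simp) hg)).ne
    · refine Eventually.of_forall fun w => ?_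
      have h1 : Continuous fun δ : ℝ => (δ / (2 * Real.pi)) • w.1 := by fun_prop
      have h2 : Tendsto (fun δ : ℝ => (δ / (2 * Real.pi)) • w.1) (𝓝 0) (𝓝 0) := by
        simpa using h1.tendsto 0
      have h3 := ENNReal.Tendsto.const_mul ((tendsto_translationModulus g).comp h2)
        (Or.inr (enorm_ne_top (x := w.2)))
      simpa using h3
  simpa using key

theorem SchwartzMap.exists_eventually_eq_one (a : 𝔼 n) :
    ∃ τ : 𝓢(𝔼 n, ℂ), ∀ᶠ y in 𝓝 a, τ y = 1 := by
  let b : ContDiffBump a := ⟨1, 2, one_pos, one_lt_two⟩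
  have hd : ContDiff ℝ (⊤ : ℕ∞) fun y => ((b y : ℝ) : ℂ) := Complex.ofRealCLM.contDiff.comp b.contDiff
  have hcs : HasCompactSupport fun y => ((b y : ℝ) : ℂ) :=
    b.hasCompactSupport.comp_left (g := fun r : ℝ => (r : ℂ)) Complex.ofReal_zero
  refine ⟨hcs.toSchwartzMap hd, ?_⟩
  filter_upwards [b.eventuallyEq_one] with y hy
  simpa using hy

/-- Near a point, the increment of a superposition of characters coincides with a superposition
of characters of small mass. -/
theorem IsCharSum.exists_eventually_eq_sub {s : ℝ} (hs : 0 ≤ s) {A B : ℝ≥0} {f : (𝔼 n) → ℂ}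
    (hf : IsCharSum s A B f) (a : 𝔼 n) {ε : ℝ≥0} (hε : 0 < ε) :
    ∃ h B', IsCharSum s ε B' h ∧ ∀ᶠ t in 𝓝 a, h t = f t - f a := by
  obtain ⟨μ, hμ, hA, hB, hf⟩ := hf
  obtain ⟨τ, hτ⟩ := SchwartzMap.exists_eventually_eq_one (0 : 𝔼 n)
  have hA' : expMass 0 μ < ∞ := hA.trans_lt ENNReal.coe_lt_top
  have hB' : expMass s μ < ∞ := hB.trans_lt ENNReal.coe_lt_top
  -- Restricting to the punctured neighbourhood yields an admissible `δ ≠ 0`; its sign is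
  -- irrelevant.
  have hev := ((tendsto_lintegral_translationModulus (𝓕 τ) μ hA').eventually
    (gt_mem_nhds (ENNReal.coe_pos.2 hε))).filter_mono (nhdsWithin_le_nhds (s := {0}ᶜ))
  obtain ⟨δ, hδ, hδ0⟩ := (hev.and self_mem_nhdsWithin).exists
  have hδ0 : δ ≠ 0 := hδ0
  obtain ⟨B₁, hB₁⟩ := IsCharSum.exists_cutoff hs τ.eq_integral_fourier hδ0 a μ hA' hB'
  refine ⟨_, B₁, hB₁.mono ?_ le_rfl, ?_⟩
  · exact (ENNReal.toNNReal_mono ENNReal.coe_ne_top hδ.le).trans_eq (ENNReal.toNNReal_coe ε)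
  · have hcont : Continuous fun t : 𝔼 n => δ⁻¹ • (t - a) := by fun_prop
    have ht : Tendsto (fun t : 𝔼 n => δ⁻¹ • (t - a)) (𝓝 a) (𝓝 0) := by
      simpa using hcont.tendsto a
    filter_upwards [ht.eventually hτ] with t h
    rw [h, hf, hf, one_mul]

/-- Near a point, the composition of an analytic function and a superposition of characters
coincides with a superposition of characters. -/
theorem IsCharSum.exists_eventually_eq_comp {s : ℝ} (hs : 0 ≤ s) {A B : ℝ≥0} {f : (𝔼 n) → ℂ}
    (hf : IsCharSum s A B f) (a : 𝔼 n) {F : ℂ → ℂ} (hF : AnalyticAt ℂ F (f a)) :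
    ∃ G A' B', IsCharSum s A' B' G ∧ ∀ᶠ t in 𝓝 a, G t = F (f t) := by
  obtain ⟨q, r, hq⟩ := hF
  obtain ⟨r₀, hr₀, hr⟩ := ENNReal.lt_iff_exists_nnreal_btwn.1 hq.r_pos
  have hr₀' : 0 < r₀ := ENNReal.coe_pos.1 hr₀
  -- Mass at most `r₀ / 2 < r₀ < r` places the increment strictly inside the disc of convergence.
  obtain ⟨h, B₁, hh, he⟩ := hf.exists_eventually_eq_sub hs a (half_pos hr₀')
  obtain ⟨A', B', hG⟩ := IsCharSum.comp_hasFPowerSeriesOnBall hs hh hq hr (half_lt_self hr₀')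
  refine ⟨_, A', B', hG, ?_⟩
  filter_upwards [he] with t ht
  rw [ht, add_sub_cancel]

end LocalSmallness

/-! ### Localized superpositions of characters belong to modulation spaces -/

section ModulationMembership

open Filter Topology FourierTransform
open scoped NNReal

variable {n : ℕ}

local notation "𝔼" n => EuclideanSpace ℝ (Fin n)

/-- The short-time Fourier transform of `v` is dominated by a product of an integrable bounded
function of position and a function of frequency with finite weighted integral. -/
def HasStftMajorant (s : ℝ) (φ : 𝓢(𝔼 n, ℂ)) (v : 𝓢'(𝔼 n, ℂ)) : Prop :=
  ∃ D : (𝔼 n) → ℝ≥0∞, Measurable D ∧ ∫⁻ ξ, D ξ * ENNReal.ofReal (polyWeight s ξ) < ∞ ∧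
    ∀ x ξ, ‖stft φ v x ξ‖ₑ ≤ ENNReal.ofReal (decayWeight x) * D ξ

theorem HasStftMajorant.zero (s : ℝ) (φ : 𝓢(𝔼 n, ℂ)) : HasStftMajorant s φ 0 := by
  refine ⟨fun _ => 0, measurable_const, by simp, fun x ξ => ?_⟩
  have : stft φ 0 x ξ = 0 := rfl
  simp [this]

theorem HasStftMajorant.add {s : ℝ} {φ : 𝓢(𝔼 n, ℂ)} {v v' : 𝓢'(𝔼 n, ℂ)}
    (h : HasStftMajorant s φ v) (h' : HasStftMajorant s φ v') : HasStftMajorant s φ (v + v') := by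
  obtain ⟨D, h1, h2, h3⟩ := h
  obtain ⟨D', h1', h2', h3'⟩ := h'
  refine ⟨fun ξ => D ξ + D' ξ, h1.add h1', ?_, fun x ξ => ?_⟩
  · simp_rw [add_mul]
    have hm : Measurable fun ξ => D ξ * ENNReal.ofReal (polyWeight s ξ) :=
      h1.mul (continuous_polyWeight s).measurable.ennreal_ofReal
    rw [lintegral_add_left hm]
    exact ENNReal.add_lt_top.2 ⟨h2, h2'⟩
  · have : stft φ (v + v') x ξ = stft φ v x ξ + stft φ v' x ξ := rfl
    rw [this, mul_add]
    exact (enorm_add_le _ _).trans (add_le_add (h3 x ξ) (h3' x ξ))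

theorem HasStftMajorant.mem_modulationSpace {p : ℝ≥0∞} (hp : 1 ≤ p) {s : ℝ} (hs : 0 ≤ s)
    {φ : 𝓢(𝔼 n, ℂ)} {v : 𝓢'(𝔼 n, ℂ)} (h : HasStftMajorant s φ v) :
    v ∈ modulationSpace φ p 1 s := by
  obtain ⟨D, h1, h2, h3⟩ := h
  have hm : Measurable fun ξ => D ξ * ENNReal.ofReal (polyWeight s ξ) :=
    h1.mul (continuous_polyWeight s).measurable.ennreal_ofReal
  have hfin : ∀ᵐ ξ, D ξ * ENNReal.ofReal (polyWeight s ξ) < ∞ := ae_lt_top hm h2.ne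
  have hP : eLpNorm (decayWeight : (𝔼 n) → ℝ) p volume < ∞ := (memLp_decayWeight hp).2
  have hle : ∀ᵐ ξ : 𝔼 n, ENNReal.ofReal (Real.sqrt (1 + ‖ξ‖ ^ 2) ^ s)
      * eLpNorm (fun x => stft φ v x ξ) p volume
      ≤ (D ξ * ENNReal.ofReal (polyWeight s ξ)) * eLpNorm (decayWeight : (𝔼 n) → ℝ) p volume := by
    filter_upwards [hfin] with ξ hξ
    -- The weight is positive, so `D ξ` is finite wherever the weighted product is; this permits
    -- pulling it out of the `L^p` norm as a finite constant.
    have hD : D ξ ≠ ∞ := by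
      intro hD
      rw [hD, ENNReal.top_mul (by simpa using polyWeight_pos s ξ)] at hξ
      exact lt_irrefl _ hξ
    have h4 : eLpNorm (fun x => stft φ v x ξ) p volume
        ≤ (D ξ).toNNReal • eLpNorm (decayWeight : (𝔼 n) → ℝ) p volume := by
      refine eLpNorm_le_nnreal_smul_eLpNorm_of_ae_le_mul' (Eventually.of_forall fun x => ?_) p
      rw [ENNReal.coe_toNNReal hD, Real.enorm_of_nonneg (decayWeight_pos x).le, mul_comm]
      exact h3 x ξ
    rw [ENNReal.smul_def, ENNReal.coe_toNNReal hD, smul_eq_mul] at h4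
    calc _ ≤ ENNReal.ofReal (polyWeight s ξ)
          * (D ξ * eLpNorm (decayWeight : (𝔼 n) → ℝ) p volume) :=
          mul_le_mul' (ENNReal.ofReal_le_ofReal (sqrt_rpow_le_polyWeight hs ξ)) h4
      _ = _ := by ring
  change modulationNorm φ p 1 s v < ∞
  rw [modulationNorm, eLpNorm_one_eq_lintegral_enorm]
  simp only [enorm_eq_self]
  refine (lintegral_mono_ae hle).trans_lt ?_
  rw [lintegral_mul_const _ hm]
  exact ENNReal.mul_lt_top h2 hP

theorem IsContinuousRep.zero : IsContinuousRep (0 : 𝓢'(𝔼 n, ℂ)) fun _ => 0 := by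
  refine ⟨continuous_const, fun ψ => ⟨by simp, ?_⟩⟩
  have : (0 : 𝓢'(𝔼 n, ℂ)) ψ = 0 := rfl
  simp [this]

theorem IsContinuousRep.add {v v' : 𝓢'(𝔼 n, ℂ)} {g g' : (𝔼 n) → ℂ} (h : IsContinuousRep v g)
    (h' : IsContinuousRep v' g') : IsContinuousRep (v + v') fun x => g x + g' x := by
  refine ⟨h.1.add h'.1, fun ψ => ?_⟩
  simp_rw [add_mul]
  refine ⟨(h.2 ψ).1.add (h'.2 ψ).1, ?_⟩
  rw [integral_add (h.2 ψ).1 (h'.2 ψ).1, ← (h.2 ψ).2, ← (h'.2 ψ).2]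
  rfl

theorem exists_isContinuousRep_sum {ι : Type*} (I : Finset ι) {s : ℝ} {φ : 𝓢(𝔼 n, ℂ)}
    {g : ι → (𝔼 n) → ℂ} (h : ∀ i ∈ I, ∃ v, IsContinuousRep v (g i) ∧ HasStftMajorant s φ v) :
    ∃ v, IsContinuousRep v (fun x => ∑ i ∈ I, g i x) ∧ HasStftMajorant s φ v := by
  classical
  induction I using Finset.induction_on with
  | empty => exact ⟨0, by simpa using IsContinuousRep.zero, .zero s φ⟩
  | insert i I hi ih =>
    obtain ⟨v, h1, h2⟩ := ih fun j hj => h j (Finset.mem_insert_of_mem hj)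
    obtain ⟨v', h1', h2'⟩ := h i (Finset.mem_insert_self _ _)
    refine ⟨v' + v, ?_, h2'.add h2⟩
    simp_rw [Finset.sum_insert hi]
    exact h1'.add h1

theorem exists_isContinuousRep_of_integrable {g : (𝔼 n) → ℂ} (hg : Continuous g)
    (hi : Integrable g) : ∃ v : 𝓢'(𝔼 n, ℂ), IsContinuousRep v g := by
  refine ⟨Lp.toTemperedDistribution ((memLp_one_iff_integrable.2 hi).toLp g), hg, fun ψ => ⟨?_, ?_⟩⟩
  · obtain ⟨C, hC, h⟩ := ψ.exists_one_add_pow_mul_le 0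
    refine hi.mul_bdd (c := C) ψ.continuous.aestronglyMeasurable (Eventually.of_forall fun x => ?_)
    simpa using h x
  · rw [Lp.toTemperedDistribution_apply]
    refine integral_congr_ae ?_
    filter_upwards [(memLp_one_iff_integrable.2 hi).coeFn_toLp] with x hx
    rw [hx, smul_eq_mul, mul_comm]

theorem SchwartzMap.fourier_inv_two_pi_smul (h : 𝓢(𝔼 n, ℂ)) (η : 𝔼 n) :
    𝓕 h ((2 * Real.pi)⁻¹ • η)
      = ∫ t, h t * Complex.exp (-Complex.I * ((inner ℝ t η : ℝ) : ℂ)) := by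
  rw [SchwartzMap.fourier_coe, Real.fourier_eq]
  refine integral_congr_ae (Eventually.of_forall fun t => ?_)
  have h1 := cexp_neg_I_inner_two_pi_smul t ((2 * Real.pi)⁻¹ • η)
  rw [smul_inv_smul₀ (by positivity)] at h1
  simp only
  rw [h1, Circle.smul_def, smul_eq_mul, mul_comm, real_inner_comm]

theorem continuous_expIntegral {V : Type*} [NormedAddCommGroup V] [InnerProductSpace ℝ V]
    [MeasurableSpace V] [BorelSpace V] [SecondCountableTopology V] {μ : Measure (V × ℂ)}
    (h : expMass 0 μ < ∞) : Continuous (expIntegral μ) := by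
  refine continuous_of_dominated (bound := fun w => ‖w.2‖)
    (fun t => (continuous_expIntegral_integrand t).aestronglyMeasurable)
    (fun t => Eventually.of_forall fun w => by simp) ?_ (Eventually.of_forall fun w => ?_)
  · refine ⟨continuous_snd.norm.aestronglyMeasurable, ?_⟩
    rw [expMass_zero_eq] at h
    simpa [HasFiniteIntegral] using h
  · exact continuous_const.mul (continuous_const.charExp continuous_id)

/-- A character only shifts the frequency variable, so the transform is a frequency convolution of
the amplitudes with the Fourier transform of `t ↦ χ(t) conj (φ(t - x))`, which decays rapidly in
both `x` and frequency. -/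
theorem stft_mul_expIntegral {χ φ : 𝓢(𝔼 n, ℂ)} {μ : Measure ((𝔼 n) × ℂ)} [SFinite μ]
    (h : expMass 0 μ < ∞) {v : 𝓢'(𝔼 n, ℂ)}
    (hv : IsContinuousRep v fun t => χ t * expIntegral μ t) (x ξ : 𝔼 n) :
    stft φ v x ξ
      = ∫ w, w.2 * 𝓕 ((χ.mulShift φ.conj).slice x) ((2 * Real.pi)⁻¹ • (ξ - w.1)) ∂μ := by
  have h0 : Integrable (fun w : (𝔼 n) × ℂ => w.2) μ := by
    refine ⟨continuous_snd.aestronglyMeasurable, ?_⟩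
    rw [expMass_zero_eq] at h
    exact h
  set S := (χ.mulShift φ.conj).slice x with hS
  have hSi : Integrable S := S.integrable
  have hc : Continuous fun z : ((𝔼 n) × ℂ) × (𝔼 n) =>
      Complex.exp (-Complex.I * ((inner ℝ z.2 (ξ - z.1.1) : ℝ) : ℂ)) := by fun_prop
  have hi : Integrable (fun z : ((𝔼 n) × ℂ) × (𝔼 n) =>
      z.1.2 * S z.2 * Complex.exp (-Complex.I * ((inner ℝ z.2 (ξ - z.1.1) : ℝ) : ℂ)))
      (μ.prod volume) := by
    refine (h0.mul_prod hSi).mul_bdd (c := 1) hc.aestronglyMeasurable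
      (Eventually.of_forall fun z => ?_)
    rw [show -Complex.I * ((inner ℝ z.2 (ξ - z.1.1) : ℝ) : ℂ)
      = ((-(inner ℝ z.2 (ξ - z.1.1)) : ℝ) : ℂ) * Complex.I by push_cast; ring]
    exact (Complex.norm_exp_ofReal_mul_I _).le
  have key : ∀ (w : (𝔼 n) × ℂ) (t : 𝔼 n),
      w.2 * S t * Complex.exp (-Complex.I * ((inner ℝ t (ξ - w.1) : ℝ) : ℂ))
        = χ t * conjShift φ x ξ t * (w.2 * charExp w.1 t) := by
    intro w t
    have e : Complex.exp (-Complex.I * ((inner ℝ t (ξ - w.1) : ℝ) : ℂ))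
        = Complex.exp (-Complex.I * ((inner ℝ t ξ : ℝ) : ℂ)) * charExp w.1 t := by
      rw [charExp, ← Complex.exp_add, inner_sub_right]
      congr 1
      push_cast
      ring
    rw [e, hS, SchwartzMap.slice_apply, SchwartzMap.mulShift_apply, SchwartzMap.conj_apply,
      conjShift_apply]
    ring
  simp_rw [SchwartzMap.fourier_inv_two_pi_smul, ← integral_const_mul, ← mul_assoc]
  rw [integral_integral_swap hi, stft, (hv.2 _).2]
  refine integral_congr_ae (Eventually.of_forall fun t => ?_)
  simp only [key]
  rw [integral_const_mul, expIntegral]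
  ring

theorem lintegral_convolution_mul_polyWeight_le {s : ℝ} (hs : 0 ≤ s) {k : (𝔼 n) → ℝ≥0∞}
    (hk : Measurable k) (μ : Measure ((𝔼 n) × ℂ)) [SFinite μ] :
    ∫⁻ ξ, (∫⁻ w, ‖w.2‖ₑ * k (ξ - w.1) ∂μ) * ENNReal.ofReal (polyWeight s ξ)
      ≤ expMass s μ * ∫⁻ ξ, k ξ * ENNReal.ofReal (polyWeight s ξ) := by
  have hW : Measurable fun ξ : 𝔼 n => ENNReal.ofReal (polyWeight s ξ) :=
    (continuous_polyWeight s).measurable.ennreal_ofReal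
  have hk1 : Measurable fun z : (𝔼 n) × ((𝔼 n) × ℂ) => k (z.1 - z.2.1) :=
    hk.comp (by fun_prop)
  have hW1 : Measurable fun z : (𝔼 n) × ((𝔼 n) × ℂ) => ENNReal.ofReal (polyWeight s z.1) :=
    hW.comp measurable_fst
  have h2 : Measurable fun z : (𝔼 n) × ((𝔼 n) × ℂ) => ‖z.2.2‖ₑ := by fun_prop
  have hm := (h2.mul hk1).mul hW1
  have e : ∀ ξ : 𝔼 n, (∫⁻ w, ‖w.2‖ₑ * k (ξ - w.1) ∂μ) * ENNReal.ofReal (polyWeight s ξ)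
      = ∫⁻ w, ‖w.2‖ₑ * k (ξ - w.1) * ENNReal.ofReal (polyWeight s ξ) ∂μ := fun ξ =>
    (lintegral_mul_const _ ((h2.mul hk1).comp measurable_prodMk_left)).symm
  simp_rw [e]
  rw [lintegral_lintegral_swap hm.aemeasurable, expMass,
    ← lintegral_mul_const _ (measurable_expMass_integrand s)]
  refine lintegral_mono fun w => ?_
  have hkW : Measurable fun ξ : 𝔼 n => k (ξ - w.1) * ENNReal.ofReal (polyWeight s (ξ - w.1)) :=
    (hk.mul hW).comp (measurable_id.sub_const w.1)
  calc ∫⁻ ξ, ‖w.2‖ₑ * k (ξ - w.1) * ENNReal.ofReal (polyWeight s ξ)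
      ≤ ∫⁻ ξ, ‖w.2‖ₑ * ENNReal.ofReal (polyWeight s w.1)
        * (k (ξ - w.1) * ENNReal.ofReal (polyWeight s (ξ - w.1))) := by
        refine lintegral_mono fun ξ => ?_
        have h3 := polyWeight_add_le hs w.1 (ξ - w.1)
        rw [add_sub_cancel] at h3
        have h4 := ENNReal.ofReal_le_ofReal h3
        rw [ENNReal.ofReal_mul (polyWeight_pos s _).le] at h4
        refine (mul_le_mul_right h4 _).trans (le_of_eq ?_)
        ring
    _ = _ := by
        rw [lintegral_const_mul _ hkW,
          lintegral_sub_right_eq_self (fun ξ => k ξ * ENNReal.ofReal (polyWeight s ξ))]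

theorem lintegral_inv_pow_mul_polyWeight_lt_top (s : ℝ) {C : ℝ} (hC : 0 ≤ C) :
    ∫⁻ ξ : 𝔼 n, ENNReal.ofReal (C * ((1 + ‖ξ‖) ^
      ((volume : Measure (𝔼 n)).integrablePower + ⌈s⌉₊))⁻¹) * ENNReal.ofReal (polyWeight s ξ)
      < ∞ := by
  have hlt : ∫⁻ ξ : 𝔼 n, ENNReal.ofReal (C * decayWeight ξ) < ∞ :=
    ((integrable_decayWeight (V := 𝔼 n)).const_mul C).lintegral_lt_top
  refine (lintegral_mono fun ξ => ?_).trans_lt hlt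
  rw [← ENNReal.ofReal_mul (by positivity), mul_assoc]
  exact ENNReal.ofReal_le_ofReal (mul_le_mul_of_nonneg_left (inv_pow_mul_polyWeight_le s ξ) hC)

/-- The product of a Schwartz function and a superposition of characters with finite weighted mass
belongs to all modulation spaces of that weight. -/
theorem IsCharSum.exists_isContinuousRep_mul {s : ℝ} (hs : 0 ≤ s) {A B : ℝ≥0} {G : (𝔼 n) → ℂ}
    (hG : IsCharSum s A B G) (χ φ : 𝓢(𝔼 n, ℂ)) :
    ∃ v, IsContinuousRep v (fun t => χ t * G t) ∧ HasStftMajorant s φ v := by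
  have hbd := hG.norm_le
  obtain ⟨μ, hμ, hA, hB, hG⟩ := hG
  obtain rfl : G = expIntegral μ := funext hG
  have hA' : expMass 0 μ < ∞ := hA.trans_lt ENNReal.coe_lt_top
  have hB' : expMass s μ < ∞ := hB.trans_lt ENNReal.coe_lt_top
  have hc := continuous_expIntegral hA'
  obtain ⟨v, hv⟩ := exists_isContinuousRep_of_integrable (χ.continuous.mul hc)
    (χ.integrable.mul_bdd (c := (A : ℝ)) hc.aestronglyMeasurable (Eventually.of_forall hbd))
  refine ⟨v, hv, ?_⟩
  -- This power absorbs the weight, of order at most `⌈s⌉₊`, and still leaves an integrable factor.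
  set M := (volume : Measure (𝔼 n)).integrablePower + ⌈s⌉₊ with hM
  obtain ⟨C, hC, h⟩ := (χ.mulShift φ.conj).exists_fourier_slice_le_decayWeight M
  have hk : Measurable fun ξ : 𝔼 n =>
      ENNReal.ofReal (C * (2 * Real.pi) ^ M * ((1 + ‖ξ‖) ^ M)⁻¹) := by fun_prop
  have hm : Measurable fun z : (𝔼 n) × ((𝔼 n) × ℂ) =>
      ‖z.2.2‖ₑ * ENNReal.ofReal (C * (2 * Real.pi) ^ M * ((1 + ‖z.1 - z.2.1‖) ^ M)⁻¹) := by
    fun_prop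
  refine ⟨fun ξ => ∫⁻ w, ‖w.2‖ₑ * ENNReal.ofReal
    (C * (2 * Real.pi) ^ M * ((1 + ‖ξ - w.1‖) ^ M)⁻¹) ∂μ, hm.lintegral_prod_right',
    (lintegral_convolution_mul_polyWeight_le hs hk μ).trans_lt (ENNReal.mul_lt_top hB'
      (lintegral_inv_pow_mul_polyWeight_lt_top s (by positivity))), fun x ξ => ?_⟩
  have hm' : Measurable fun w : (𝔼 n) × ℂ =>
      ‖w.2‖ₑ * ENNReal.ofReal (C * (2 * Real.pi) ^ M * ((1 + ‖ξ - w.1‖) ^ M)⁻¹) := by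
    fun_prop
  rw [stft_mul_expIntegral hA' hv, ← lintegral_const_mul _ hm']
  refine (enorm_integral_le_lintegral_enorm _).trans ?_
  refine lintegral_mono fun w => ?_
  rw [enorm_mul, mul_left_comm]
  refine mul_le_mul_right ?_ _
  rw [← ofReal_norm, ← ENNReal.ofReal_mul (decayWeight_pos x).le]
  refine ENNReal.ofReal_le_ofReal ((h x _).trans ?_)
  have h1 : ((1 + ‖(2 * Real.pi)⁻¹ • (ξ - w.1)‖) ^ M)⁻¹
      ≤ (2 * Real.pi) ^ M * ((1 + ‖ξ - w.1‖) ^ M)⁻¹ := by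
    rw [← div_eq_mul_inv, inv_eq_one_div, div_le_div_iff₀ (by positivity) (by positivity), one_mul,
      ← mul_pow]
    refine pow_le_pow_left₀ (by positivity) ?_ _
    rw [norm_smul, Real.norm_of_nonneg (by positivity), mul_add,
      mul_inv_cancel_left₀ (by positivity)]
    linarith [Real.pi_gt_three]
  have h2 := mul_le_mul_of_nonneg_left h1 (mul_nonneg hC (decayWeight_pos x).le)
  refine h2.trans (le_of_eq ?_)
  ring

end ModulationMembership

/-! ### Patching local representations on compact sets -/

section Patching

open Filter Topology
open scoped NNReal Manifold ContDiff

variable {n : ℕ}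

local notation "𝔼" n => EuclideanSpace ℝ (Fin n)

/-- Finite smooth partitions of unity by Schwartz functions subordinate to a neighbourhood
assignment on a compact set. -/
theorem IsCompact.exists_schwartz_partition {K : Set (𝔼 n)} (hK : IsCompact K)
    {O : (𝔼 n) → Set (𝔼 n)} (hO : ∀ a ∈ K, O a ∈ 𝓝 a) :
    ∃ (I : Finset (𝔼 n)) (χ : (𝔼 n) → 𝓢(𝔼 n, ℂ)), (∀ a ∈ I, a ∈ K) ∧
      (∀ a ∈ I, ∀ t, t ∉ O a → χ a t = 0) ∧ ∀ t ∈ K, ∑ a ∈ I, χ a t = 1 := by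
  classical
  -- Intersecting with unit balls makes the partition functions compactly supported, hence Schwartz.
  let U : (𝔼 n) → Set (𝔼 n) := fun a => interior (O a) ∩ Metric.ball a 1
  obtain ⟨I, hIK, hI⟩ := hK.elim_nhds_subcover U fun a ha =>
    inter_mem (interior_mem_nhds.2 (hO a ha)) (Metric.ball_mem_nhds a one_pos)
  obtain ⟨b, hb⟩ := SmoothPartitionOfUnity.exists_isSubordinate 𝓘(ℝ, 𝔼 n) hK.isClosed
    (fun a : I => U a) (fun a => isOpen_interior.inter Metric.isOpen_ball)
    (fun t ht => by simpa using hI ht)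
  have hcs : ∀ a : I, HasCompactSupport fun t => ((b a t : ℝ) : ℂ) := fun a => by
    have h1 : HasCompactSupport (b a) :=
      (isCompact_closedBall (a : 𝔼 n) 1).of_isClosed_subset (isClosed_tsupport _)
        ((hb a).trans (Set.inter_subset_right.trans Metric.ball_subset_closedBall))
    exact h1.comp_left (g := fun r : ℝ => (r : ℂ)) Complex.ofReal_zero
  have hd : ∀ a : I, ContDiff ℝ ∞ fun t => ((b a t : ℝ) : ℂ) := fun a =>
    Complex.ofRealCLM.contDiff.comp (b a).contMDiff.contDiff
  refine ⟨I, fun a => if ha : a ∈ I then (hcs ⟨a, ha⟩).toSchwartzMap (hd ⟨a, ha⟩) else 0, hIK,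
    fun a ha t ht => ?_, fun t ht => ?_⟩
  · have h1 : b ⟨a, ha⟩ t = 0 := by
      by_contra h
      exact ht (interior_subset (hb ⟨a, ha⟩ (subset_tsupport _ h)).1)
    simp [ha, h1]
  · have h1 := b.sum_eq_one ht
    rw [finsum_eq_sum_of_fintype] at h1
    rw [← Finset.sum_attach]
    have h2 : ∀ a : I, (if ha : (a : 𝔼 n) ∈ I then (hcs ⟨a, ha⟩).toSchwartzMap (hd ⟨a, ha⟩)
        else (0 : 𝓢(𝔼 n, ℂ))) t = ((b a t : ℝ) : ℂ) := fun a => by simp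
    simp only [h2]
    rw [← Complex.ofReal_sum, Complex.ofReal_eq_one]
    exact h1

variable {p : ℝ≥0∞} {s : ℝ} {φ : 𝓢(𝔼 n, ℂ)} {u : 𝓢'(𝔼 n, ℂ)}

/-- Near each point, an analytic function of the continuous representative of an element of a
modulation space is a superposition of characters. -/
theorem exists_isCharSum_eventually_eq_comp_stftInversion (hp : 1 ≤ p) (hs : 0 ≤ s)
    (hu : u ∈ modulationSpace φ p 1 s) (a : 𝔼 n) {F : ℂ → ℂ}
    (hF : AnalyticAt ℂ F (stftInversion φ u a)) :
    ∃ G A B, IsCharSum s A B G ∧ ∀ᶠ t in 𝓝 a, G t = F (stftInversion φ u t) := by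
  obtain ⟨χ, hχ⟩ := SchwartzMap.exists_eventually_eq_one a
  obtain ⟨A, B, hf⟩ := exists_isCharSum_mul_stftInversion hp hs hu χ
  have ha : χ a * stftInversion φ u a = stftInversion φ u a := by rw [hχ.self_of_nhds, one_mul]
  obtain ⟨G, A', B', hG, he⟩ := hf.exists_eventually_eq_comp hs a (F := F) (by rwa [ha])
  refine ⟨G, A', B', hG, ?_⟩
  filter_upwards [he, hχ] with t h1 h2
  rw [h1, h2, one_mul]

theorem exists_mem_modulationSpace_eqOn_comp_stftInversion (hp : 1 ≤ p) (hs : 0 ≤ s)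
    (hu : u ∈ modulationSpace φ p 1 s) {K : Set (𝔼 n)} (hK : IsCompact K) {F : ℂ → ℂ}
    (hF : ∀ a ∈ K, AnalyticAt ℂ F (stftInversion φ u a)) :
    ∃ v ∈ modulationSpace φ p 1 s, ∃ g : (𝔼 n) → ℂ,
      IsContinuousRep v g ∧ ∀ x ∈ K, g x = F (stftInversion φ u x) := by
  have hloc : ∀ a : 𝔼 n, ∃ G : (𝔼 n) → ℂ, a ∈ K → (∃ A B, IsCharSum s A B G) ∧
      ∀ᶠ t in 𝓝 a, G t = F (stftInversion φ u t) := fun a => by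
    by_cases ha : a ∈ K
    · obtain ⟨G, A, B, h1, h2⟩ :=
        exists_isCharSum_eventually_eq_comp_stftInversion hp hs hu a (hF a ha)
      exact ⟨G, fun _ => ⟨⟨A, B, h1⟩, h2⟩⟩
    · exact ⟨0, fun h => absurd h ha⟩
  choose G hG using hloc
  obtain ⟨I, χ, hI, hχ, hsum⟩ := hK.exists_schwartz_partition
    (O := fun a => {t | G a t = F (stftInversion φ u t)}) fun a ha => (hG a ha).2
  obtain ⟨v, hv, hv'⟩ := exists_isContinuousRep_sum (s := s) (φ := φ) I
    (g := fun a t => χ a t * G a t) fun a ha => by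
      obtain ⟨A, B, h⟩ := (hG a (hI a ha)).1
      exact h.exists_isContinuousRep_mul hs (χ a) φ
  refine ⟨v, hv'.mem_modulationSpace hp hs, _, hv, fun x hx => ?_⟩
  rw [← one_mul (F _), ← hsum x hx, Finset.sum_mul]
  refine Finset.sum_congr rfl fun a ha => ?_
  -- Where the local representation fails, `x` lies outside the set to which `χ a` is subordinate,
  -- so the term vanishes on both sides.
  by_cases h : G a x = F (stftInversion φ u x)
  · rw [h]
  · rw [hχ a ha x h, zero_mul, zero_mul]

end Patching

theorem mainTheorem1 (n : ℕ) (p : ℝ≥0∞) (hp : 1 ≤ p) (hp' : p ≠ ∞) (s : ℝ) (hs : 0 ≤ s)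
    (φ : 𝓢(EuclideanSpace ℝ (Fin n), ℂ)) (hφ : φ ≠ 0)
    (u : 𝓢'(EuclideanSpace ℝ (Fin n), ℂ)) (hu : u ∈ modulationSpace φ p 1 s) :
    (∃! f : EuclideanSpace ℝ (Fin n) → ℂ, IsContinuousRep u f) ∧
    ∀ f : EuclideanSpace ℝ (Fin n) → ℂ, IsContinuousRep u f →
      ∀ K : Set (EuclideanSpace ℝ (Fin n)), IsCompact K →
      ∀ (U : Set ℂ) (F : ℂ → ℂ), IsOpen U → f '' K ⊆ U → AnalyticOnNhd ℂ F U →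
        ∃ v ∈ modulationSpace φ p 1 s, ∃ g : EuclideanSpace ℝ (Fin n) → ℂ,
          IsContinuousRep v g ∧ ∀ x ∈ K, g x = F (f x) := by
  have hrep := isContinuousRep_stftInversion hp hs hφ hu
  refine ⟨⟨_, hrep, fun f hf => hf.eq hrep⟩, fun f hf K hK U F _ hKU hF => ?_⟩
  -- Uniqueness of the continuous representative reduces the claim to the function given by the
  -- inversion formula.
  obtain rfl := hf.eq hrep
  exact exists_mem_modulationSpace_eqOn_comp_stftInversion hp hs hu hK fun a ha =>
    hF _ (hKU ⟨a, ha, rfl⟩)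

end
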